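/- Let $N\ge 1$ and let $\tau$ be a partition of $N$ with Ferrers diagram $\{(i,j):1\le i\le \ell(\tau),\,1\le j\le\tau_i\}$. Let $\mathcal Y(\tau)$ be the set of reverse standard Young tableaux of shape $\tau$ (fillings with $1,\dots,N$, each used once, decreasing in rows and columns), let $\operatorname{row}(i,S)$, $\operatorname{col}(i,S)$ be the row and column of the entry $i$ in $S$ and $c(i,S)=\operatorname{col}(i,S)-\operatorname{row}(i,S)$, and let $h_\tau=\tau_1+\ell(\tau)-1$ be the maximal hook length. Let $q,t>0$ be real with $q,t\neq1$, and put $u(z)=\frac{(t-z)(1-tz)}{(1-z)^2}$ and $(z;q)_m=\prod_{l=0}^{m-1}(1-zq^l)$. Operators act on the right. The Hecke algebra of $\mathcal S_N$ with generators $T_1,\dots,T_{N-1}$ acts on the real vector space $V_\tau$ with basis $\mathcal Y(\tau)$ as follows, where $S^{(i)}$ is $S$ with $i$ and $i+1$ exchanged and $b=c(i,S)-c(i+1,S)$: $S\tau(T_i)=tS$ if $i,i+1$ are in the same row; $S\tau(T_i)=-S$ if they are in the same column; $S\tau(T_i)=S^{(i)}+\frac{t-1}{1-t^{-b}}S$ if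 $b\ge2$; $S\tau(T_i)=\frac{t(t^{b+1}-1)(t^{b-1}-1)}{(t^b-1)^2}S^{(i)}+\frac{t^b(t-1)}{t^b-1}S$ if $b\le-2$. On $\mathcal P_\tau=\mathbb R[x_1,\dots,x_N]\otimes V_\tau$ put, with $s_i$ exchanging the $i$-th and $(i+1)$-st entries, $$(p\otimes S)\boldsymbol T_i=(1-t)x_{i+1}\frac{p(x)-p(x.s_i)}{x_i-x_{i+1}}\otimes S+p(x.s_i)\otimes S\tau(T_i),$$ $$(p\otimes S)\boldsymbol w=p(qx_N,x_1,\dots,x_{N-1})\otimes S\tau(T_1T_2\cdots T_{N-1}).$$ For $\alpha\in\mathbb N_0^N$ let $r_\alpha(i)=\#\{j:\alpha_j>\alpha_i\}+\#\{j\le i:\alpha_j=\alpha_i\}$ and $\zeta_{\alpha,S}(i)=q^{\alpha_i}t^{c(r_\alpha(i),S)}$. The vector-valued nonsymmetric Macdonald polynomials $M_{\alpha,S}\in\mathcal P_\tau$ ($\alpha\in\mathbb N_0^N$, $S\in\mathcal Y(\tau)$) are produced by the Yang-Baxter graph: $M_{\boldsymbol 0,S}=1\otimes S$; if $\alpha_N\ge1$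 then $M_{\alpha,S}=x_N(M_{\beta,S}\boldsymbol w)$ with $\beta=(\alpha_N-1,\alpha_1,\dots,\alpha_{N-1})$; and if $\alpha\ne\boldsymbol 0$, $\alpha_N=0$, then $$M_{\alpha,S}=M_{\beta,S}\boldsymbol T_i+\frac{t-1}{\zeta_{\beta,S}(i+1)/\zeta_{\beta,S}(i)-1}M_{\beta,S},\qquad \beta=\alpha.s_i,$$ where $i$ is the largest index with $\alpha_i>\alpha_{i+1}$. For $S\in\mathcal Y(\tau)$ let $\|S\|_0^2=\prod_{i<j,\;c(j,S)-c(i,S)\ge2}u(t^{c(i,S)-c(j,S)})$. Write $\lambda=\alpha^+$ for the nonincreasing rearrangement of $\alpha$, $|\lambda|=\sum_i\lambda_i$, $k(\lambda)=\sum_{i=1}^N(N-2i+1)\lambda_i$, $c_{ij}=c(i,S)-c(j,S)$. The bilinear form $\langle\cdot,\cdot\rangle$ on $\mathcal P_\tau$ is the one determined by $\langle M_{\alpha,S},M_{\beta,S'}\rangle=0$ for $(\alpha,S)\ne(\beta,S')$ and, with $\|f\|^2=\langle f,f\rangle$, $$\|M_{\lambda,S}\|^2=t^{k(\lambda)}\|S\|_0^2\,(1-q)^{-|\lambda|}\prod_{i=1}^N(qt^{c(i,S)};q)_{\lambda_i}\prod_{1\le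 i<j\le N}\frac{(qt^{c_{ij}-1};q)_{\lambda_i-\lambda_j}(qt^{c_{ij}+1};q)_{\lambda_i-\lambda_j}}{(qt^{c_{ij}};q)^2_{\lambda_i-\lambda_j}},$$ $$\|M_{\alpha,S}\|^2=\Big(\prod_{i<j,\;\alpha_i<\alpha_j}u\big(q^{\alpha_j-\alpha_i}t^{c(r_\alpha(j),S)-c(r_\alpha(i),S)}\big)\Big)^{-1}\|M_{\alpha^+,S}\|^2 .$$ **Proposition.** Suppose $\dim V_\tau\ge2$, $q,t>0$, $q\neq1$ and $t\ne1$. The condition $$q<\min(t^{-h_\tau},t^{h_\tau})\quad\text{or}\quad q>\max(t^{-h_\tau},t^{h_\tau})$$ is equivalent to $$\min(q^{-1/h_\tau},q^{1/h_\tau})<t<\max(q^{-1/h_\tau},q^{1/h_\tau}).$$ If it holds, then the $M_{\alpha,S}$ form a basis of $\mathcal P_\tau$, so that the above prescription defines a symmetric bilinear form on $\mathcal P_\tau$, and this form is positive-definite: $\langle f,f\rangle>0$ for every $f\in\mathcal P_\tau$ with $f\ne0$; in particular $\|M_{\alpha,S}\|^2>0$ for all $\alpha\in\mathbb N_0^N$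 and $S\in\mathcal Y(\tau)$. -/

import Mathlib

open scoped TensorProduct

/- Throughout, `N = n + 1`.  The indices `1, …, N` of the variables, of the entries of a tableau and
of the parts of a composition are the elements of `Fin (n + 1)`; the index `i` of a generator `T_i`
is an element of `Fin n`, the generator belonging to the positions `i.castSucc` and `i.succ`. -/

namespace VVMacdonald

section Tableaux

/-- Reverse standard Young tableaux of shape `τ`: bijections between the entries and the boxes
such that the entries decrease in each row and in each column.  A box is a pair (row, column). -/
structure RSYT (n : ℕ) (τ : YoungDiagram) where
  box : Fin (n + 1) ≃ τ.cells
  row_decreasing : ∀ i j : Fin (n + 1),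
    (box i).1.1 = (box j).1.1 → (box i).1.2 < (box j).1.2 → j < i
  col_decreasing : ∀ i j : Fin (n + 1),
    (box i).1.2 = (box j).1.2 → (box i).1.1 < (box j).1.1 → j < i

variable {n : ℕ} {τ : YoungDiagram}

/-- The row of the entry `i` in `S`. -/
def RSYT.row (S : RSYT n τ) (i : Fin (n + 1)) : ℕ := (S.box i).1.1

/-- The column of the entry `i` in `S`. -/
def RSYT.col (S : RSYT n τ) (i : Fin (n + 1)) : ℕ := (S.box i).1.2

/-- The content (column minus row) of the entry `i` in `S`. -/
def RSYT.content (S : RSYT n τ) (i : Fin (n + 1)) : ℤ := (S.col i : ℤ) - (S.row i : ℤ)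

theorem swap_lt_of_lt {i : Fin n} {a b : Fin (n + 1)}
    (h : Equiv.swap i.castSucc i.succ b < Equiv.swap i.castSucc i.succ a)
    (hab : ¬ (Equiv.swap i.castSucc i.succ a = i.succ ∧
      Equiv.swap i.castSucc i.succ b = i.castSucc)) : b < a := by
  simp only [Equiv.swap_apply_def, Fin.ext_iff, Fin.lt_def, Fin.val_castSucc, Fin.val_succ]
    at h hab ⊢
  split_ifs at h hab <;> simp_all <;> omega

/-- The tableau `S^(i)`, obtained from `S` by exchanging two consecutive entries that lie
neither in the same row nor in the same column. -/
def RSYT.exchange (S : RSYT n τ) (i : Fin n) (hr : S.row i.castSucc ≠ S.row i.succ)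
    (hc : S.col i.castSucc ≠ S.col i.succ) : RSYT n τ where
  box := (Equiv.swap i.castSucc i.succ).trans S.box
  row_decreasing a b h₁ h₂ := by
    refine swap_lt_of_lt (i := i) (S.row_decreasing _ _ h₁ h₂) ?_
    rintro ⟨ha, hb⟩
    simp only [Equiv.trans_apply, ha, hb] at h₁
    exact hr h₁.symm
  col_decreasing a b h₁ h₂ := by
    refine swap_lt_of_lt (i := i) (S.col_decreasing _ _ h₁ h₂) ?_
    rintro ⟨ha, hb⟩
    simp only [Equiv.trans_apply, ha, hb] at h₁
    exact hc h₁.symm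

end Tableaux

section Representation

variable {n : ℕ} {τ : YoungDiagram}

/-- The module `V_τ`, with basis the reverse standard Young tableaux of shape `τ`. -/
abbrev V (n : ℕ) (τ : YoungDiagram) : Type := RSYT n τ →₀ ℝ

/-- `u(z) = (t - z)(1 - z t) / (1 - z)²`. -/
noncomputable def u (t z : ℝ) : ℝ := (t - z) * (1 - z * t) / (1 - z) ^ 2

open Classical in
/-- The vector `S τ(T_i)`. -/
noncomputable def tauTBasis (t : ℝ) (i : Fin n) (S : RSYT n τ) : V n τ :=
  if hr : S.row i.castSucc = S.row i.succ then Finsupp.single S t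
  else if hc : S.col i.castSucc = S.col i.succ then Finsupp.single S (-1)
  else if 2 ≤ S.content i.castSucc - S.content i.succ then
    Finsupp.single (S.exchange i hr hc) 1 +
      Finsupp.single S ((t - 1) / (1 - t ^ (S.content i.succ - S.content i.castSucc)))
  else
    let b : ℤ := S.content i.castSucc - S.content i.succ
    Finsupp.single (S.exchange i hr hc)
        (t * (t ^ (b + 1) - 1) * (t ^ (b - 1) - 1) / (t ^ b - 1) ^ 2) +
      Finsupp.single S (t ^ b * (t - 1) / (t ^ b - 1))

/-- The operator `τ(T_i)` on `V_τ`. -/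
noncomputable def tauT (t : ℝ) (i : Fin n) : V n τ →ₗ[ℝ] V n τ :=
  Finsupp.linearCombination ℝ (tauTBasis t i)

/-- The operator `τ(ω)`, `ω = T_1 T_2 ⋯ T_{N-1}`.  Operators act on the right of their arguments,
so that `T_1` is applied first. -/
noncomputable def tauOmega (t : ℝ) : V n τ →ₗ[ℝ] V n τ :=
  (List.finRange n).foldl (fun A i => tauT t i ∘ₗ A) LinearMap.id

/-- The squared norm `⟨S, S⟩₀` of a tableau. -/
noncomputable def normSqTableau (t : ℝ) (S : RSYT n τ) : ℝ :=
  ∏ p : Fin (n + 1) × Fin (n + 1) with p.1 < p.2 ∧ 2 ≤ S.content p.2 - S.content p.1,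
    u t (t ^ (S.content p.1 - S.content p.2))

end Representation

section Polynomials

variable {n : ℕ} {τ : YoungDiagram}

/-- The polynomial `p(x.s_i)`. -/
noncomputable def swapVars (i : Fin n) :
    MvPolynomial (Fin (n + 1)) ℝ →ₐ[ℝ] MvPolynomial (Fin (n + 1)) ℝ :=
  MvPolynomial.rename (Equiv.swap i.castSucc i.succ)

theorem X_sub_X_ne_zero (i : Fin n) :
    (MvPolynomial.X i.castSucc - MvPolynomial.X i.succ : MvPolynomial (Fin (n + 1)) ℝ) ≠ 0 := by
  rw [sub_ne_zero]
  intro h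
  exact (Fin.castSucc_lt_succ (i := i)).ne (MvPolynomial.X_injective h)

theorem X_sub_X_dvd (i : Fin n) (p : MvPolynomial (Fin (n + 1)) ℝ) :
    (MvPolynomial.X i.castSucc - MvPolynomial.X i.succ) ∣ p - swapVars i p := by
  rw [← Ideal.mem_span_singleton, ← Ideal.Quotient.mk_eq_mk_iff_sub_mem]
  set I : Ideal (MvPolynomial (Fin (n + 1)) ℝ) :=
    Ideal.span {MvPolynomial.X i.castSucc - MvPolynomial.X i.succ}
  have hX : Ideal.Quotient.mkₐ ℝ I (MvPolynomial.X i.castSucc) =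
      Ideal.Quotient.mkₐ ℝ I (MvPolynomial.X i.succ) :=
    (Ideal.Quotient.mk_eq_mk_iff_sub_mem _ _).2 (Ideal.subset_span rfl)
  have h : Ideal.Quotient.mkₐ ℝ I = (Ideal.Quotient.mkₐ ℝ I).comp (swapVars i) := by
    apply MvPolynomial.algHom_ext
    intro k
    simp only [AlgHom.comp_apply, swapVars, MvPolynomial.rename_X]
    rcases eq_or_ne k i.castSucc with rfl | h₁
    · rw [Equiv.swap_apply_left, hX]
    · rcases eq_or_ne k i.succ with rfl | h₂
      · rw [Equiv.swap_apply_right, hX]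
      · rw [Equiv.swap_apply_of_ne_of_ne h₁ h₂]
  exact DFunLike.congr_fun h p

/-- The divided difference `(p(x) - p(x.s_i)) / (x_i - x_{i+1})`. -/
noncomputable def divDiff (i : Fin n) :
    MvPolynomial (Fin (n + 1)) ℝ →ₗ[ℝ] MvPolynomial (Fin (n + 1)) ℝ where
  toFun p := (X_sub_X_dvd i p).choose
  map_add' p r := by
    apply mul_left_cancel₀ (X_sub_X_ne_zero i)
    rw [mul_add, ← (X_sub_X_dvd i (p + r)).choose_spec, ← (X_sub_X_dvd i p).choose_spec,
      ← (X_sub_X_dvd i r).choose_spec, map_add]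
    ring
  map_smul' a p := by
    apply mul_left_cancel₀ (X_sub_X_ne_zero i)
    rw [RingHom.id_apply, mul_smul_comm, ← (X_sub_X_dvd i (a • p)).choose_spec,
      ← (X_sub_X_dvd i p).choose_spec, map_smul, smul_sub]

theorem mul_divDiff (i : Fin n) (p : MvPolynomial (Fin (n + 1)) ℝ) :
    (MvPolynomial.X i.castSucc - MvPolynomial.X i.succ) * divDiff i p = p - swapVars i p :=
  (X_sub_X_dvd i p).choose_spec.symm

/-- The substitution `p ↦ p(q x_N, x_1, …, x_{N-1})`. -/
noncomputable def shift (q : ℝ) :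
    MvPolynomial (Fin (n + 1)) ℝ →ₐ[ℝ] MvPolynomial (Fin (n + 1)) ℝ :=
  MvPolynomial.aeval (Fin.cons (MvPolynomial.C q * MvPolynomial.X (Fin.last n))
    (fun k : Fin n => MvPolynomial.X k.castSucc))

/-- The space `P_τ = P ⊗ V_τ` of vector-valued polynomials. -/
abbrev P (n : ℕ) (τ : YoungDiagram) : Type := MvPolynomial (Fin (n + 1)) ℝ ⊗[ℝ] V n τ

/-- The operator `T_i` on `P_τ`:
`p ⊗ S ↦ (1 - t) x_{i+1} (p(x) - p(x.s_i)) / (x_i - x_{i+1}) ⊗ S + p(x.s_i) ⊗ S τ(T_i)`. -/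
noncomputable def bT (t : ℝ) (i : Fin n) : P n τ →ₗ[ℝ] P n τ :=
  TensorProduct.map
      ((1 - t) • (LinearMap.mulLeft ℝ (MvPolynomial.X i.succ) ∘ₗ divDiff i)) LinearMap.id +
    TensorProduct.map (swapVars i).toLinearMap (tauT t i)

/-- The operator `w` on `P_τ`: `p ⊗ S ↦ p(q x_N, x_1, …, x_{N-1}) ⊗ S τ(ω)`. -/
noncomputable def bw (q t : ℝ) : P n τ →ₗ[ℝ] P n τ :=
  TensorProduct.map (shift q).toLinearMap (tauOmega t)

/-- Multiplication by `x_N` on `P_τ`. -/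
noncomputable def mulXLast : P n τ →ₗ[ℝ] P n τ :=
  TensorProduct.map (LinearMap.mulLeft ℝ (MvPolynomial.X (Fin.last n))) LinearMap.id

end Polynomials

section Macdonald

variable {n : ℕ} {τ : YoungDiagram}

/-- The rank function
`r_α(i) = #{j : α_j > α_i} + #{j : j ≤ i, α_j = α_i}`, lowered by one because `Fin (n + 1)` starts
at zero: the index `j = i` is left out of the second set. -/
def rank (α : Fin (n + 1) → ℕ) (i : Fin (n + 1)) : Fin (n + 1) :=
  ⟨(Finset.univ.filter fun j => α i < α j ∨ (j < i ∧ α j = α i)).card, by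
    have h := Finset.card_lt_univ_of_notMem
      (s := Finset.univ.filter fun j => α i < α j ∨ (j < i ∧ α j = α i)) (x := i) (by simp)
    simpa using h⟩

/-- The spectral vector `ζ_{α,S}(i) = q^{α_i} t^{c(r_α(i), S)}`. -/
noncomputable def spectral (q t : ℝ) (α : Fin (n + 1) → ℕ) (S : RSYT n τ) (i : Fin (n + 1)) : ℝ :=
  q ^ α i * t ^ S.content (rank α i)

/-- The composition `α.s_i`. -/
def swapComp (α : Fin (n + 1) → ℕ) (i : Fin n) : Fin (n + 1) → ℕ :=
  fun j => α (Equiv.swap i.castSucc i.succ j)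

/-- The composition `(α_N - 1, α_1, …, α_{N-1})`, whose image under `Φ` is `α` if `α_N ≥ 1`. -/
def phiInv (α : Fin (n + 1) → ℕ) : Fin (n + 1) → ℕ :=
  Fin.cons (α (Fin.last n) - 1) (fun k : Fin n => α k.castSucc)

/-- The set of descents of a composition: the `i` with `α_i > α_{i+1}`. -/
def descents (α : Fin (n + 1) → ℕ) : Finset (Fin n) :=
  Finset.univ.filter fun i => α i.succ < α i.castSucc

theorem sum_phiInv_lt (α : Fin (n + 1) → ℕ) (h : 1 ≤ α (Fin.last n)) :
    ∑ j, phiInv α j < ∑ j, α j := by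
  rw [Fin.sum_univ_succ, Fin.sum_univ_castSucc (f := α)]
  simp only [phiInv, Fin.cons_zero, Fin.cons_succ]
  omega

theorem sum_swapComp (α : Fin (n + 1) → ℕ) (i : Fin n) : ∑ j, swapComp α i j = ∑ j, α j :=
  Equiv.sum_comp (Equiv.swap i.castSucc i.succ) α

theorem weight_swapComp_lt (α : Fin (n + 1) → ℕ) (i : Fin n) (h : α i.succ < α i.castSucc) :
    ∑ j : Fin (n + 1), (n - (j : ℕ)) * swapComp α i j <
      ∑ j : Fin (n + 1), (n - (j : ℕ)) * α j := by
  have hne : i.castSucc ≠ i.succ := (Fin.castSucc_lt_succ (i := i)).ne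
  have hmem : i.succ ∈ (Finset.univ.erase i.castSucc : Finset (Fin (n + 1))) := by
    simp [hne.symm]
  have key : ∀ f : Fin (n + 1) → ℕ, ∑ j, f j = f i.castSucc + (f i.succ +
      ∑ j ∈ (Finset.univ.erase i.castSucc).erase i.succ, f j) := by
    intro f
    rw [Finset.add_sum_erase _ f hmem, Finset.add_sum_erase _ f (Finset.mem_univ _)]
  rw [key, key (fun j : Fin (n + 1) => (n - (j : ℕ)) * α j)]
  have hrest : ∑ j ∈ (Finset.univ.erase i.castSucc).erase i.succ, (n - (j : ℕ)) * swapComp α i j =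
      ∑ j ∈ (Finset.univ.erase i.castSucc).erase i.succ, (n - (j : ℕ)) * α j := by
    refine Finset.sum_congr rfl fun j hj => ?_
    simp only [Finset.mem_erase, Finset.mem_univ, and_true] at hj
    rw [swapComp, Equiv.swap_apply_of_ne_of_ne hj.2 hj.1]
  rw [hrest]
  simp only [swapComp, Equiv.swap_apply_left, Equiv.swap_apply_right, Fin.val_castSucc,
    Fin.val_succ]
  obtain ⟨m, hm⟩ : ∃ m, n = (i : ℕ) + 1 + m := ⟨n - (i + 1), by omega⟩
  have h₁ : n - (i : ℕ) = m + 1 := by omega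
  have h₂ : n - ((i : ℕ) + 1) = m := by omega
  rw [h₁, h₂]
  nlinarith

/-- The vector-valued nonsymmetric Macdonald polynomial `M_{α,S}`, produced from `1 ⊗ S` along the
edges of the Yang-Baxter graph: the affine step `M_{βΦ,S} = x_N (M_{β,S} w)` if `α = βΦ`, and
otherwise the step `M_{β.s_i,S} = M_{β,S} T_i + (t - 1) / (ζ_{β,S}(i+1) / ζ_{β,S}(i) - 1) M_{β,S}`
with `α = β.s_i` and `β_i < β_{i+1}`, where `i` is the last descent of `α`.  If `α_N = 0` and `α`
has no descent then `α = 0`. -/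
noncomputable def macdonald (q t : ℝ) (S : RSYT n τ) (α : Fin (n + 1) → ℕ) : P n τ :=
  if _hN : 1 ≤ α (Fin.last n) then
    mulXLast (bw q t (macdonald q t S (phiInv α)))
  else if hd : (descents α).Nonempty then
    let i : Fin n := (descents α).max' hd
    let β : Fin (n + 1) → ℕ := swapComp α i
    bT t i (macdonald q t S β) +
      ((t - 1) / (spectral q t β S i.succ / spectral q t β S i.castSucc - 1)) •
        macdonald q t S β
  else 1 ⊗ₜ[ℝ] Finsupp.single S 1
termination_by (∑ j, α j, ∑ j : Fin (n + 1), (n - (j : ℕ)) * α j)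
decreasing_by
  · exact Prod.Lex.left _ _ (sum_phiInv_lt α _hN)
  all_goals
    rw [sum_swapComp]
    refine Prod.Lex.right _ (weight_swapComp_lt α _ ?_)
    have := (descents α).max'_mem hd
    simpa [descents] using this

end Macdonald

section Form

variable {n : ℕ} {τ : YoungDiagram}

/-- The `q`-shifted factorial `(z; q)_m = (1 - z)(1 - z q) ⋯ (1 - z q^{m-1})`. -/
noncomputable def qPoch (q z : ℝ) (m : ℕ) : ℝ := ∏ l ∈ Finset.range m, (1 - z * q ^ l)

/-- The nonincreasing rearrangement `α⁺`. -/
def sortComp (α : Fin (n + 1) → ℕ) : Fin (n + 1) → ℕ := fun i => α (Tuple.sort α i.rev)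

/-- `k(λ) = ∑_{i=1}^N (N - 2 i + 1) λ_i`; with indices starting at zero the coefficient is
`n - 2 i`. -/
def kExp (l : Fin (n + 1) → ℕ) : ℤ := ∑ i : Fin (n + 1), ((n : ℤ) - 2 * (i : ℤ)) * (l i : ℤ)

/-- The product `E(α, S)`. -/
noncomputable def prodE (q t : ℝ) (α : Fin (n + 1) → ℕ) (S : RSYT n τ) : ℝ :=
  ∏ p : Fin (n + 1) × Fin (n + 1) with p.1 < p.2 ∧ α p.1 < α p.2,
    u t (q ^ (α p.2 - α p.1) * t ^ (S.content (rank α p.2) - S.content (rank α p.1)))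

/-- The squared norm of `M_{λ,S}` for a partition `λ`. -/
noncomputable def normSqPartition (q t : ℝ) (l : Fin (n + 1) → ℕ) (S : RSYT n τ) : ℝ :=
  t ^ kExp l * normSqTableau t S * ((1 - q) ^ (∑ i, l i))⁻¹ *
    (∏ i, qPoch q (q * t ^ S.content i) (l i)) *
    ∏ p : Fin (n + 1) × Fin (n + 1) with p.1 < p.2,
      qPoch q (q * t ^ (S.content p.1 - S.content p.2 - 1)) (l p.1 - l p.2) *
        qPoch q (q * t ^ (S.content p.1 - S.content p.2 + 1)) (l p.1 - l p.2) /
          qPoch q (q * t ^ (S.content p.1 - S.content p.2)) (l p.1 - l p.2) ^ 2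

/-- The squared norm of `M_{α,S}` for a composition `α`. -/
noncomputable def normSq (q t : ℝ) (α : Fin (n + 1) → ℕ) (S : RSYT n τ) : ℝ :=
  (prodE q t α S)⁻¹ * normSqPartition q t (sortComp α) S

/-- The family `(α, S) ↦ M_{α,S}`. -/
noncomputable def macdonaldFamily (n : ℕ) (τ : YoungDiagram) (q t : ℝ) :
    (Fin (n + 1) → ℕ) × RSYT n τ → P n τ :=
  fun p => macdonald q t p.2 p.1

open Classical in
/-- The bilinear form on `P_τ` for which the `M_{α,S}` are mutually orthogonal with
`⟨M_{α,S}, M_{α,S}⟩ = normSq q t α S`.  It is defined through the basis `(M_{α,S})`; the value zero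
is only a placeholder, used if the family were not a basis. -/
noncomputable def form (n : ℕ) (τ : YoungDiagram) (q t : ℝ) : LinearMap.BilinForm ℝ (P n τ) :=
  if h : LinearIndependent ℝ (macdonaldFamily n τ q t) ∧
      ⊤ ≤ Submodule.span ℝ (Set.range (macdonaldFamily n τ q t)) then
    (Module.Basis.mk h.1 h.2).constr ℝ
      (fun p => normSq q t p.1 p.2 • (Module.Basis.mk h.1 h.2).coord p)
  else 0

end Form

/-- The maximal hook length `h_τ = τ_1 + ℓ(τ) - 1` of a nonempty diagram. -/
def maxHook (τ : YoungDiagram) : ℕ := τ.rowLen 0 + τ.colLen 0 - 1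

end VVMacdonald

/-!
The two descriptions of the region both say `h |log t| < |log q|` for the maximal hook length `h`
(`region_iff`).  In this region every `1 - q^{l+1} t^m` with `|m| ≤ h` has the sign of `1 - q`
(`one_sub_mul_pos`).  Contents and differences of contents are bounded by `h - 1` in absolute value,
so all the factors of the squared norms that involve `q` have this shape and the signs cancel, while
`‖S‖₀²` is positive for every positive `t ≠ 1` (`normSq_pos`).

The Macdonald polynomials form a basis for all `q ≠ 0`, `t > 0`, `t ≠ 1`, and neither eigenvalues
nor a dominance order are needed to see it.  If `k` is the last nonzero position of a composition
`α`, then the Yang-Baxter path to `α` ends with an affine step followed by steps at the last descent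
that carry the last entry down to position `k`.  Setting the variables beyond `k` to zero kills the
divided differences and the scalar corrections of these steps.  What is left is an affine step in
the first `k` variables, applied to the polynomial of the composition `γ` with `insertComp k γ = α`,
whose degree is one less (`killP_macdonald_insertComp`).  This step multiplies by `x_k` and is
injective, and it is onto the multiples of `x_k` in the first `k` variables, because the `τ(T_i)` are
invertible by the quadratic relation (`tauT_tauT`).  Independence and spanning both follow by
induction on the degree and the number of variables: compositions with `α_k = 0` are treated modulo
`x_k`, the others through the affine step (`eq_zero_of_killP_linearCombination`,
`monoSpan_le_macSpan`).
-/

namespace VVMacdonald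

/-! ### Contents of tableaux -/

section Contents

variable {n : ℕ} {τ : YoungDiagram}

theorem RSYT.row_lt_colLen (S : RSYT n τ) (i : Fin (n + 1)) : S.row i < τ.colLen 0 := by
  have h : ((S.box i).1.1, (S.box i).1.2) ∈ τ := (S.box i).2
  exact τ.mem_iff_lt_colLen.1 (τ.up_left_mem le_rfl (Nat.zero_le _) h)

theorem RSYT.col_lt_rowLen (S : RSYT n τ) (i : Fin (n + 1)) : S.col i < τ.rowLen 0 := by
  have h : ((S.box i).1.1, (S.box i).1.2) ∈ τ := (S.box i).2
  exact τ.mem_iff_lt_rowLen.1 (τ.up_left_mem (Nat.zero_le _) le_rfl h)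

theorem RSYT.abs_content_lt (S : RSYT n τ) (i : Fin (n + 1)) :
    |S.content i| < maxHook τ := by
  have h₁ := S.row_lt_colLen i
  have h₂ := S.col_lt_rowLen i
  rw [abs_lt]
  simp only [RSYT.content, maxHook]
  omega

theorem RSYT.abs_content_sub_lt (S : RSYT n τ) (i j : Fin (n + 1)) :
    |S.content i - S.content j| < maxHook τ := by
  have h₁ := S.row_lt_colLen i
  have h₂ := S.col_lt_rowLen i
  have h₃ := S.row_lt_colLen j
  have h₄ := S.col_lt_rowLen j
  rw [abs_lt]
  simp only [RSYT.content, maxHook]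
  omega

/-- If one of two boxes lies strictly below and to the right of the other, then the corner of the
rectangle they span holds an entry strictly between theirs. -/
theorem RSYT.exists_between (S : RSYT n τ) {a b : Fin (n + 1)} (hr : S.row a < S.row b)
    (hc : S.col a < S.col b) : ∃ e, b < e ∧ e < a := by
  have hb : ((S.box b).1.1, (S.box b).1.2) ∈ τ := (S.box b).2
  have he : ((S.box a).1.1, (S.box b).1.2) ∈ τ.cells := τ.up_left_mem hr.le le_rfl hb
  refine ⟨S.box.symm ⟨_, he⟩, ?_, ?_⟩
  · apply S.col_decreasing <;> simp only [Equiv.apply_symm_apply]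
    exact hr
  · apply S.row_decreasing <;> simp only [Equiv.apply_symm_apply]
    exact hc

/-- Consecutive entries in different rows and columns have contents differing by at least two: no
entry fits strictly between them, so one of the boxes lies strictly above and to the right of the
other. -/
theorem RSYT.two_le_abs_content_sub (S : RSYT n τ) (i : Fin n)
    (hr : S.row i.castSucc ≠ S.row i.succ) (hc : S.col i.castSucc ≠ S.col i.succ) :
    2 ≤ |S.content i.castSucc - S.content i.succ| := by
  have h₁ : ¬ (S.row i.castSucc < S.row i.succ ∧ S.col i.castSucc < S.col i.succ) := by
    rintro ⟨h, h'⟩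
    obtain ⟨e, he, he'⟩ := S.exists_between h h'
    simp only [Fin.lt_def, Fin.val_castSucc, Fin.val_succ] at he he'
    omega
  have h₂ : ¬ (S.row i.succ < S.row i.castSucc ∧ S.col i.succ < S.col i.castSucc) := by
    rintro ⟨h, h'⟩
    obtain ⟨e, he, he'⟩ := S.exists_between h h'
    simp only [Fin.lt_def, Fin.val_castSucc, Fin.val_succ] at he he'
    omega
  rw [le_abs]
  simp only [RSYT.content]
  omega

end Contents

/-! ### The Hecke algebra action on tableaux is invertible -/

section Hecke

variable {n : ℕ} {τ : YoungDiagram}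

@[ext]
theorem RSYT.ext {S S' : RSYT n τ} (h : S.box = S'.box) : S = S' := by
  cases S; cases S'; simp_all

theorem RSYT.exchange_row_castSucc (S : RSYT n τ) (i : Fin n)
    (hr : S.row i.castSucc ≠ S.row i.succ) (hc : S.col i.castSucc ≠ S.col i.succ) :
    (S.exchange i hr hc).row i.castSucc = S.row i.succ := by
  simp [RSYT.exchange, RSYT.row]

theorem RSYT.exchange_row_succ (S : RSYT n τ) (i : Fin n)
    (hr : S.row i.castSucc ≠ S.row i.succ) (hc : S.col i.castSucc ≠ S.col i.succ) :
    (S.exchange i hr hc).row i.succ = S.row i.castSucc := by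
  simp [RSYT.exchange, RSYT.row]

theorem RSYT.exchange_col_castSucc (S : RSYT n τ) (i : Fin n)
    (hr : S.row i.castSucc ≠ S.row i.succ) (hc : S.col i.castSucc ≠ S.col i.succ) :
    (S.exchange i hr hc).col i.castSucc = S.col i.succ := by
  simp [RSYT.exchange, RSYT.col]

theorem RSYT.exchange_col_succ (S : RSYT n τ) (i : Fin n)
    (hr : S.row i.castSucc ≠ S.row i.succ) (hc : S.col i.castSucc ≠ S.col i.succ) :
    (S.exchange i hr hc).col i.succ = S.col i.castSucc := by
  simp [RSYT.exchange, RSYT.col]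

theorem RSYT.exchange_exchange (S : RSYT n τ) (i : Fin n)
    (hr : S.row i.castSucc ≠ S.row i.succ) (hc : S.col i.castSucc ≠ S.col i.succ) (hr' hc') :
    (S.exchange i hr hc).exchange i hr' hc' = S := by
  ext k : 2
  simp [RSYT.exchange]

/-- The coefficient of `S^(i)` in `S τ(T_i)`, as a function of the content difference `b`. -/
noncomputable def offCoeff (t : ℝ) (b : ℤ) : ℝ :=
  if 2 ≤ b then 1 else t * (t ^ (b + 1) - 1) * (t ^ (b - 1) - 1) / (t ^ b - 1) ^ 2

/-- The coefficient of `S` in `S τ(T_i)`, as a function of the content difference `b`. -/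
noncomputable def diagCoeff (t : ℝ) (b : ℤ) : ℝ := t ^ b * (t - 1) / (t ^ b - 1)

theorem zpow_ne_one_of_ne_zero {t : ℝ} (ht : 0 < t) (ht1 : t ≠ 1) {b : ℤ} (hb : b ≠ 0) :
    t ^ b ≠ 1 := by
  rw [Ne, zpow_eq_one_iff_right₀ ht.le ht1]
  exact hb

theorem diagCoeff_add_neg {t : ℝ} (ht : 0 < t) (ht1 : t ≠ 1) {b : ℤ} (hb : b ≠ 0) :
    diagCoeff t b + diagCoeff t (-b) = t - 1 := by
  have h := sub_ne_zero.2 (zpow_ne_one_of_ne_zero ht ht1 hb)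
  have h0 := (zpow_pos ht b).ne'
  simp only [diagCoeff, zpow_neg]
  set z := t ^ b
  have h' : 1 - z ≠ 0 := by intro h1; apply h; linarith
  have : z⁻¹ - 1 = (1 - z) / z := by field_simp
  rw [this]
  field_simp
  ring

theorem diagCoeff_sq_add {t : ℝ} (ht : 0 < t) (ht1 : t ≠ 1) {b : ℤ} (hb : 2 ≤ |b|) :
    offCoeff t b * offCoeff t (-b) + diagCoeff t b ^ 2 = (t - 1) * diagCoeff t b + t := by
  have main : ∀ b : ℤ, b ≠ 0 →
      t * (t ^ (b + 1) - 1) * (t ^ (b - 1) - 1) / (t ^ b - 1) ^ 2 + diagCoeff t b ^ 2 =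
        (t - 1) * diagCoeff t b + t := by
    intro b hb
    have h := sub_ne_zero.2 (zpow_ne_one_of_ne_zero ht ht1 hb)
    simp only [diagCoeff, zpow_add_one₀ ht.ne', zpow_sub_one₀ ht.ne']
    set z := t ^ b
    field_simp
    ring
  rcases le_abs.1 hb with h | h
  · have hs := diagCoeff_add_neg ht ht1 (b := b) (by omega)
    have hm := main (-b) (by omega)
    rw [offCoeff, offCoeff, if_pos h, if_neg (by omega), one_mul]
    rw [eq_sub_of_add_eq' hs] at hm
    linear_combination hm
  · rw [offCoeff, offCoeff, if_neg (by omega), if_pos h, mul_one]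
    exact main b (by omega)

theorem tauTBasis_of_ne (t : ℝ) (i : Fin n) (S : RSYT n τ)
    (hr : S.row i.castSucc ≠ S.row i.succ) (hc : S.col i.castSucc ≠ S.col i.succ) (ht : 0 < t) :
    tauTBasis t i S =
      offCoeff t (S.content i.castSucc - S.content i.succ) •
          (Finsupp.single (S.exchange i hr hc) 1 : V n τ) +
        diagCoeff t (S.content i.castSucc - S.content i.succ) •
          (Finsupp.single S 1 : V n τ) := by
  rw [tauTBasis, dif_neg hr, dif_neg hc, offCoeff, diagCoeff, Finsupp.smul_single,
    Finsupp.smul_single, smul_eq_mul, smul_eq_mul, mul_one, mul_one]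
  split_ifs with h
  · congr 2
    rw [← neg_sub (S.content i.castSucc), zpow_neg]
    have h0 := (zpow_pos ht (S.content i.castSucc - S.content i.succ)).ne'
    set z := t ^ (S.content i.castSucc - S.content i.succ)
    have : 1 - z⁻¹ = (z - 1) / z := by field_simp
    rw [this, div_div_eq_mul_div, mul_comm]
  · rfl

/-- The quadratic relation `T_i² = (t - 1) T_i + t`. -/
theorem tauT_tauT {t : ℝ} (ht : 0 < t) (ht1 : t ≠ 1) (i : Fin n) (v : V n τ) :
    tauT t i (tauT t i v) = (t - 1) • tauT t i v + t • v := by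
  suffices h : tauT t i ∘ₗ tauT t i = (t - 1) • tauT t i + t • LinearMap.id (M := V n τ) from
    DFunLike.congr_fun h v
  ext1 S
  ext1
  have hT : ∀ (S : RSYT n τ) (a : ℝ), tauT t i (Finsupp.single S a) = a • tauTBasis t i S := by
    intro S a
    rw [tauT, Finsupp.linearCombination_single]
  simp only [LinearMap.comp_apply, LinearMap.add_apply, LinearMap.smul_apply, LinearMap.id_apply,
    Finsupp.lsingle_apply, hT, one_smul]
  by_cases hr : S.row i.castSucc = S.row i.succ
  · have : tauTBasis t i S = Finsupp.single S t := by rw [tauTBasis, dif_pos hr]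
    rw [this, hT, this]
    simp only [Finsupp.smul_single, smul_eq_mul, ← Finsupp.single_add]
    congr 1
    ring
  by_cases hc : S.col i.castSucc = S.col i.succ
  · have : tauTBasis t i S = Finsupp.single S (-1) := by
      rw [tauTBasis, dif_neg hr, dif_pos hc]
    rw [this, hT, this]
    simp only [Finsupp.smul_single, smul_eq_mul, ← Finsupp.single_add]
    congr 1
    ring
  have hr' : (S.exchange i hr hc).row i.castSucc ≠ (S.exchange i hr hc).row i.succ := by
    rw [RSYT.exchange_row_castSucc, RSYT.exchange_row_succ]
    exact Ne.symm hr
  have hc' : (S.exchange i hr hc).col i.castSucc ≠ (S.exchange i hr hc).col i.succ := by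
    rw [RSYT.exchange_col_castSucc, RSYT.exchange_col_succ]
    exact Ne.symm hc
  have hb := S.two_le_abs_content_sub i hr hc
  have hb' : (S.exchange i hr hc).content i.castSucc - (S.exchange i hr hc).content i.succ =
      -(S.content i.castSucc - S.content i.succ) := by
    simp only [RSYT.content, RSYT.exchange_row_castSucc, RSYT.exchange_row_succ,
      RSYT.exchange_col_castSucc, RSYT.exchange_col_succ]
    ring
  rw [tauTBasis_of_ne t i S hr hc ht, map_add, map_smul, map_smul, hT, hT, one_smul,
    one_smul, tauTBasis_of_ne t i _ hr' hc' ht, tauTBasis_of_ne t i S hr hc ht,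
    RSYT.exchange_exchange, hb']
  set b := S.content i.castSucc - S.content i.succ
  have h₁ := diagCoeff_add_neg ht ht1 (b := b) (by rintro h; rw [h] at hb; norm_num at hb)
  have h₂ := diagCoeff_sq_add ht ht1 hb
  have e₁ : offCoeff t b * diagCoeff t (-b) + diagCoeff t b * offCoeff t b =
      (t - 1) * offCoeff t b := by rw [← h₁]; ring
  linear_combination (norm := module) e₁ • (Finsupp.single (S.exchange i hr hc) 1 : V n τ) +
    h₂ • (Finsupp.single S 1 : V n τ)

theorem tauT_bijective {t : ℝ} (ht : 0 < t) (ht1 : t ≠ 1) (i : Fin n) :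
    Function.Bijective (tauT t i : V n τ → V n τ) := by
  refine Function.bijective_iff_has_inverse.2
    ⟨fun v => t⁻¹ • (tauT t i v - (t - 1) • v), fun v => ?_, fun v => ?_⟩
  · simp only [tauT_tauT ht ht1, add_sub_cancel_left, smul_smul, inv_mul_cancel₀ ht.ne', one_smul]
  · simp only [map_smul, map_sub, tauT_tauT ht ht1, add_sub_cancel_left, smul_smul,
      inv_mul_cancel₀ ht.ne', one_smul]

theorem tauOmega_bijective {t : ℝ} (ht : 0 < t) (ht1 : t ≠ 1) :
    Function.Bijective (tauOmega t : V n τ → V n τ) := by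
  have : ∀ (l : List (Fin n)) (A : V n τ →ₗ[ℝ] V n τ), Function.Bijective (A : V n τ → V n τ) →
      Function.Bijective (l.foldl (fun A i => tauT t i ∘ₗ A) A : V n τ →ₗ[ℝ] V n τ) := by
    intro l
    induction l with
    | nil => exact fun A hA => hA
    | cons i l ih =>
      intro A hA
      rw [List.foldl_cons]
      refine ih _ ?_
      rw [LinearMap.coe_comp]
      exact (tauT_bijective ht ht1 i).comp hA
  exact this _ _ Function.bijective_id

end Hecke

/-! ### The affine step at an arbitrary position -/

section Affine

variable {n : ℕ} {τ : YoungDiagram}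

/-- The composition `(γ_2, …, γ_k, γ_1 + 1, γ_{k+1}, …, γ_N)`; for `k = N` it is the affine
step `γΦ` of the Yang-Baxter graph. -/
def insertComp (k : Fin (n + 1)) (γ : Fin (n + 1) → ℕ) : Fin (n + 1) → ℕ :=
  k.insertNth (γ 0 + 1) (fun m : Fin n => γ m.succ)

@[simp]
theorem insertComp_same (k : Fin (n + 1)) (γ : Fin (n + 1) → ℕ) : insertComp k γ k = γ 0 + 1 :=
  Fin.insertNth_apply_same k _ _

@[simp]
theorem insertComp_succAbove (k : Fin (n + 1)) (γ : Fin (n + 1) → ℕ) (m : Fin n) :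
    insertComp k γ (k.succAbove m) = γ m.succ :=
  Fin.insertNth_apply_succAbove k _ _ m

theorem sum_insertComp (k : Fin (n + 1)) (γ : Fin (n + 1) → ℕ) :
    ∑ j, insertComp k γ j = ∑ j, γ j + 1 := by
  rw [Fin.sum_univ_succAbove _ k, Fin.sum_univ_succ (f := γ)]
  simp only [insertComp_same, insertComp_succAbove]
  omega

theorem insertComp_injective (k : Fin (n + 1)) :
    Function.Injective (insertComp k : (Fin (n + 1) → ℕ) → _) := by
  intro γ γ' h
  funext j
  refine Fin.cases ?_ (fun m => ?_) j
  · simpa using congrFun h k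
  · simpa using congrFun h (k.succAbove m)

/-- A composition whose last nonzero entry is at `k` arises from one that vanishes beyond `k`. -/
theorem exists_insertComp_eq (k : Fin (n + 1)) (α : Fin (n + 1) → ℕ)
    (hα : ∀ j, k < j → α j = 0) (hk : α k ≠ 0) :
    ∃ γ, insertComp k γ = α ∧ ∀ j, k < j → γ j = 0 := by
  refine ⟨Fin.cons (α k - 1) (fun m => α (k.succAbove m)), ?_, ?_⟩
  · funext j
    refine Fin.succAboveCases k ?_ (fun m => ?_) j
    · simp only [insertComp_same, Fin.cons_zero]
      omega
    · simp
  · intro j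
    refine Fin.cases (fun h => absurd h (Fin.not_lt_zero k)) (fun m h => ?_) j
    rw [Fin.cons_succ, Fin.succAbove_of_le_castSucc _ _ (Fin.le_castSucc_iff.2 h)]
    exact hα _ h

theorem insertComp_eq_zero (k j : Fin (n + 1)) (hk : k ≤ j) (γ : Fin (n + 1) → ℕ)
    (hγ : ∀ m, k < m → γ m = 0) (m : Fin (n + 1)) (hm : j < m) : insertComp j γ m = 0 := by
  obtain ⟨m, rfl⟩ := Fin.exists_succAbove_eq hm.ne'
  rw [insertComp_succAbove]
  refine hγ _ (hk.trans_lt ?_)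
  exact (Fin.lt_succAbove_iff_le_castSucc _ _).1 hm |> Fin.le_castSucc_iff.1

theorem phiInv_insertComp_last (γ : Fin (n + 1) → ℕ) : phiInv (insertComp (Fin.last n) γ) = γ := by
  funext j
  refine Fin.cases ?_ (fun m => ?_) j
  · simp [phiInv]
  · rw [phiInv, Fin.cons_succ, ← Fin.succAbove_last_apply, insertComp_succAbove]

theorem swapComp_insertComp (i : Fin n) (γ : Fin (n + 1) → ℕ) :
    swapComp (insertComp i.castSucc γ) i = insertComp i.succ γ := by
  funext j
  refine Fin.succAboveCases i.succ ?_ (fun m => ?_) j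
  · rw [swapComp, Equiv.swap_apply_right, insertComp_same, insertComp_same]
  · rw [insertComp_succAbove, swapComp]
    rcases lt_trichotomy m i with h | rfl | h
    · have e₁ : i.succ.succAbove m = m.castSucc := Fin.succAbove_of_castSucc_lt _ _
        (by simp only [Fin.lt_def, Fin.val_castSucc, Fin.val_succ] at h ⊢; omega)
      have e₂ : i.castSucc.succAbove m = m.castSucc := Fin.succAbove_of_castSucc_lt _ _
        (by simp only [Fin.lt_def, Fin.val_castSucc] at h ⊢; omega)
      have e₃ := insertComp_succAbove i.castSucc γ m
      rw [e₂] at e₃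
      rw [e₁, Equiv.swap_apply_of_ne_of_ne, e₃] <;>
        simp only [ne_eq, Fin.ext_iff, Fin.lt_def, Fin.val_castSucc, Fin.val_succ] at h ⊢ <;> omega
    · rw [Fin.succAbove_succ_self, Equiv.swap_apply_left]
      conv_lhs => rw [← Fin.succAbove_castSucc_self, insertComp_succAbove]
    · have e₁ : i.succ.succAbove m = m.succ := Fin.succAbove_of_le_castSucc _ _
        (by simp only [Fin.le_def, Fin.lt_def, Fin.val_castSucc, Fin.val_succ] at h ⊢; omega)
      have e₂ : i.castSucc.succAbove m = m.succ := Fin.succAbove_of_le_castSucc _ _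
        (by simp only [Fin.le_def, Fin.lt_def, Fin.val_castSucc] at h ⊢; omega)
      have e₃ := insertComp_succAbove i.castSucc γ m
      rw [e₂] at e₃
      rw [e₁, Equiv.swap_apply_of_ne_of_ne, e₃] <;>
        simp only [ne_eq, Fin.ext_iff, Fin.lt_def, Fin.val_castSucc, Fin.val_succ] at h ⊢ <;> omega

/-- The automorphism `x_1 ↦ q x_k`, `x_{m+1} ↦ x_m` for `m < k`, fixing the other variables; for
`k = N` it is `shift q`. -/
noncomputable def rot (q : ℝ) (k : Fin (n + 1)) :
    MvPolynomial (Fin (n + 1)) ℝ →ₐ[ℝ] MvPolynomial (Fin (n + 1)) ℝ :=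
  MvPolynomial.aeval (Fin.cons (MvPolynomial.C q * MvPolynomial.X k)
    (fun m : Fin n => MvPolynomial.X (k.succAbove m)))

@[simp]
theorem rot_X_zero (q : ℝ) (k : Fin (n + 1)) :
    rot q k (MvPolynomial.X 0) = MvPolynomial.C q * MvPolynomial.X k := by
  simp [rot]

@[simp]
theorem rot_X_succ (q : ℝ) (k : Fin (n + 1)) (m : Fin n) :
    rot q k (MvPolynomial.X m.succ) = MvPolynomial.X (k.succAbove m) := by
  simp [rot]

theorem rot_last (q : ℝ) : rot q (Fin.last n) = shift q := by
  apply MvPolynomial.algHom_ext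
  intro j
  refine Fin.cases ?_ (fun m => ?_) j <;> simp [shift]

theorem rot_injective {q : ℝ} (hq : q ≠ 0) (k : Fin (n + 1)) : Function.Injective (rot q k) := by
  let r : MvPolynomial (Fin (n + 1)) ℝ →ₐ[ℝ] MvPolynomial (Fin (n + 1)) ℝ :=
    MvPolynomial.aeval (k.insertNth (α := fun _ => MvPolynomial (Fin (n + 1)) ℝ)
      (MvPolynomial.C q⁻¹ * MvPolynomial.X 0) (fun m : Fin n => MvPolynomial.X m.succ))
  have h : r.comp (rot q k) = AlgHom.id ℝ _ := by
    apply MvPolynomial.algHom_ext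
    intro j
    refine Fin.cases ?_ (fun m => ?_) j
    · simp [r, ← mul_assoc, ← MvPolynomial.C_mul, hq]
    · simp [r]
  exact Function.LeftInverse.injective (g := r) fun p => DFunLike.congr_fun h p

/-- The operator `τ(T_1 ⋯ T_{N-1} T_{N-1} ⋯ T_k)`. -/
noncomputable def sigma (t : ℝ) (k : Fin (n + 1)) : V n τ →ₗ[ℝ] V n τ :=
  Fin.reverseInduction (motive := fun _ => V n τ →ₗ[ℝ] V n τ) (tauOmega t)
    (fun i A => tauT t i ∘ₗ A) k

theorem sigma_last (t : ℝ) : sigma t (Fin.last n) = (tauOmega t : V n τ →ₗ[ℝ] V n τ) :=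
  Fin.reverseInduction_last

theorem sigma_castSucc (t : ℝ) (i : Fin n) :
    sigma t i.castSucc = (tauT t i ∘ₗ sigma t i.succ : V n τ →ₗ[ℝ] V n τ) :=
  Fin.reverseInduction_castSucc ..

theorem sigma_bijective {t : ℝ} (ht : 0 < t) (ht1 : t ≠ 1) (k : Fin (n + 1)) :
    Function.Bijective (sigma t k : V n τ → V n τ) := by
  refine Fin.reverseInduction ?_ (fun i hi => ?_) k
  · rw [sigma_last]
    exact tauOmega_bijective ht ht1
  · rw [sigma_castSucc, LinearMap.coe_comp]
    exact (tauT_bijective ht ht1 i).comp hi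

/-- The operator `f ↦ x_k (f δ_k)`, where `δ_k` acts as `rot q k` on polynomials and as `sigma t k`
on tableaux; for `k = N` it is the affine step of the Yang-Baxter graph. -/
noncomputable def affineStep (q t : ℝ) (k : Fin (n + 1)) : P n τ →ₗ[ℝ] P n τ :=
  TensorProduct.map (LinearMap.mulLeft ℝ (MvPolynomial.X k) ∘ₗ (rot q k).toLinearMap) (sigma t k)

theorem affineStep_last (q t : ℝ) (f : P n τ) :
    affineStep q t (Fin.last n) f = mulXLast (bw q t f) := by
  rw [mulXLast, bw, ← LinearMap.comp_apply, ← TensorProduct.map_comp, affineStep, sigma_last,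
    rot_last, LinearMap.id_comp]

theorem affineStep_injective {q t : ℝ} (hq : q ≠ 0) (ht : 0 < t) (ht1 : t ≠ 1)
    (k : Fin (n + 1)) : Function.Injective (affineStep q t k : P n τ → P n τ) := by
  refine TensorProduct.map_injective_of_flat_flat _ _ ?_ (sigma_bijective ht ht1 k).1
  rw [LinearMap.coe_comp]
  exact (mul_right_injective₀ (MvPolynomial.X_ne_zero k)).comp (rot_injective hq k)

end Affine

/-! ### The leading part of a Macdonald polynomial -/

section Leading

variable {n : ℕ} {τ : YoungDiagram}

/-- The substitution `x_m ↦ 0` for `m ≥ k` (positions counted from zero). -/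
noncomputable def kill (k : ℕ) :
    MvPolynomial (Fin (n + 1)) ℝ →ₐ[ℝ] MvPolynomial (Fin (n + 1)) ℝ :=
  MvPolynomial.aeval fun m => if (m : ℕ) < k then MvPolynomial.X m else 0

/-- The substitution `x_j ↦ x_k`, `x_m ↦ 0` for the other `m ≥ k`. -/
noncomputable def gather (k j : Fin (n + 1)) :
    MvPolynomial (Fin (n + 1)) ℝ →ₐ[ℝ] MvPolynomial (Fin (n + 1)) ℝ :=
  MvPolynomial.aeval fun m => if m < k then MvPolynomial.X m else
    if m = j then MvPolynomial.X k else 0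

@[simp]
theorem kill_X (k : ℕ) (m : Fin (n + 1)) :
    kill k (MvPolynomial.X m) = if (m : ℕ) < k then MvPolynomial.X m else 0 := by
  simp [kill]

@[simp]
theorem gather_X (k j m : Fin (n + 1)) : gather k j (MvPolynomial.X m) =
    if m < k then MvPolynomial.X m else if m = j then MvPolynomial.X k else 0 := by
  simp [gather]

theorem gather_self (k : Fin (n + 1)) : gather k k = kill ((k : ℕ) + 1) := by
  apply MvPolynomial.algHom_ext
  intro m
  simp only [gather_X, kill_X, Fin.lt_def, Fin.ext_iff]
  split_ifs with h₁ h₂ h₂ h₃ h₃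
  · rfl
  · omega
  · rw [Fin.ext h₂]
  · omega
  · omega
  · rfl

theorem kill_comp_kill {k l : ℕ} (h : k ≤ l) :
    (kill k).comp (kill l) = (kill k : MvPolynomial (Fin (n + 1)) ℝ →ₐ[ℝ] _) := by
  apply MvPolynomial.algHom_ext
  intro m
  simp only [AlgHom.comp_apply, kill_X]
  split_ifs with h₁ h₂ h₂
  · simp [h₂]
  · simp [h₂]
  · omega
  · simp

theorem kill_of_lt {k : ℕ} (h : n < k) :
    kill k = AlgHom.id ℝ (MvPolynomial (Fin (n + 1)) ℝ) := by
  apply MvPolynomial.algHom_ext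
  intro m
  rw [kill_X, if_pos (by omega)]
  rfl

theorem gather_comp_kill {k j : Fin (n + 1)} (hkj : k ≤ j) {l : ℕ} (h : (j : ℕ) < l) :
    (gather k j).comp (kill l) = gather k j := by
  apply MvPolynomial.algHom_ext
  intro m
  simp only [AlgHom.comp_apply, kill_X]
  split_ifs with h₁
  · rfl
  · rw [map_zero, gather_X, if_neg, if_neg]
    · rintro rfl; exact h₁ h
    · rw [Fin.lt_def]; rw [Fin.le_def] at hkj; omega

theorem gather_comp_swapVars {k : Fin (n + 1)} (i : Fin n) (h : k ≤ i.castSucc) :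
    (gather k i.castSucc).comp (swapVars i) = gather k i.succ := by
  have hlt := Fin.castSucc_lt_succ (i := i)
  apply MvPolynomial.algHom_ext
  intro m
  simp only [AlgHom.comp_apply, swapVars, MvPolynomial.rename_X, gather_X]
  rcases eq_or_ne m i.castSucc with rfl | h₁
  · rw [Equiv.swap_apply_left, if_neg (h.trans hlt.le).not_gt, if_neg hlt.ne', if_neg h.not_gt,
      if_neg hlt.ne]
  rcases eq_or_ne m i.succ with rfl | h₂
  · rw [Equiv.swap_apply_right, if_neg h.not_gt, if_pos rfl, if_neg (h.trans hlt.le).not_gt,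
      if_pos rfl]
  · rw [Equiv.swap_apply_of_ne_of_ne h₁ h₂, if_neg h₁, if_neg h₂]

/-- The composite of `rot q j` and `gather k j` does not depend on `j ≥ k`. -/
theorem gather_comp_rot (q : ℝ) {k j : Fin (n + 1)} (h : k ≤ j) :
    (gather k j).comp (rot q j) = (gather k k).comp (rot q k) := by
  have key : ∀ (j : Fin (n + 1)), k ≤ j → ∀ m : Fin n,
      gather k j (MvPolynomial.X (j.succAbove m)) =
        if m.castSucc < k then MvPolynomial.X m.castSucc else 0 := by
    intro j h m
    rw [gather_X]
    split_ifs with h₁ h₂ h₂ h₃ h₃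
    · rw [Fin.succAbove_of_castSucc_lt _ _ (h₂.trans_le h)]
    · refine absurd h₁ (not_lt.2 ((not_lt.1 h₂).trans ?_))
      rw [Fin.succAbove]
      split_ifs
      exacts [le_rfl, Fin.castSucc_lt_succ.le]
    · exact absurd h₂ (Fin.succAbove_ne _ _)
    · exact absurd h₂ (Fin.succAbove_ne _ _)
    · rw [Fin.succAbove_of_castSucc_lt _ _ (h₃.trans_le h)] at h₁
      exact absurd h₃ h₁
    · rfl
  apply MvPolynomial.algHom_ext
  intro m
  refine Fin.cases ?_ (fun m => ?_) m
  · simp only [AlgHom.comp_apply, rot_X_zero, map_mul, gather_X, if_neg h.not_gt, lt_irrefl,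
      if_true, if_false, MvPolynomial.algHom_C]
  · simp only [AlgHom.comp_apply, rot_X_succ, key j h, key k le_rfl]

/-- The map `kill k ⊗ 1` on `P_τ`. -/
noncomputable def killP (k : ℕ) : P n τ →ₗ[ℝ] P n τ :=
  TensorProduct.map (kill k).toLinearMap LinearMap.id

/-- The map `gather k j ⊗ 1` on `P_τ`. -/
noncomputable def gatherP (k j : Fin (n + 1)) : P n τ →ₗ[ℝ] P n τ :=
  TensorProduct.map (gather k j).toLinearMap LinearMap.id

theorem killP_killP {k l : ℕ} (h : k ≤ l) (f : P n τ) : killP k (killP l f) = killP k f := by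
  rw [killP, killP, ← LinearMap.comp_apply, ← TensorProduct.map_comp, ← AlgHom.comp_toLinearMap,
    kill_comp_kill h, LinearMap.id_comp]

theorem killP_of_lt {k : ℕ} (h : n < k) (f : P n τ) : killP k f = f := by
  rw [killP, kill_of_lt h, AlgHom.toLinearMap_id, TensorProduct.map_id, LinearMap.id_apply]

theorem gatherP_killP {k j : Fin (n + 1)} (hkj : k ≤ j) {l : ℕ} (h : (j : ℕ) < l) (f : P n τ) :
    gatherP k j (killP l f) = gatherP k j f := by
  rw [killP, gatherP, ← LinearMap.comp_apply, ← TensorProduct.map_comp, ← AlgHom.comp_toLinearMap,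
    gather_comp_kill hkj h, LinearMap.id_comp]

/-- `gatherP` removes the divided-difference term of `T_i`. -/
theorem gatherP_bT (t : ℝ) {k : Fin (n + 1)} (i : Fin n) (h : k ≤ i.castSucc) (f : P n τ) :
    gatherP k i.castSucc (bT t i f) =
      TensorProduct.map LinearMap.id (tauT t i) (gatherP k i.succ f) := by
  suffices e : gatherP k i.castSucc ∘ₗ bT t i =
      TensorProduct.map LinearMap.id (tauT t i) ∘ₗ (gatherP k i.succ : P n τ →ₗ[ℝ] P n τ) from
    DFunLike.congr_fun e f
  refine TensorProduct.ext' fun p v => ?_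
  have h₁ : gather k i.castSucc (MvPolynomial.X i.succ) = 0 := by
    have hlt := Fin.castSucc_lt_succ (i := i)
    rw [gather_X, if_neg (h.trans hlt.le).not_gt, if_neg hlt.ne']
  have h₂ : gather k i.castSucc (swapVars i p) = gather k i.succ p :=
    DFunLike.congr_fun (gather_comp_swapVars i h) p
  simp [gatherP, bT, h₁, h₂]

theorem gatherP_affineStep_castSucc (q t : ℝ) {k : Fin (n + 1)} (i : Fin n) (h : k ≤ i.castSucc)
    (f : P n τ) : gatherP k i.castSucc (affineStep q t i.castSucc f) =
      TensorProduct.map LinearMap.id (tauT t i)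
        (gatherP k i.succ (affineStep q t i.succ f)) := by
  suffices e : gatherP k i.castSucc ∘ₗ affineStep q t i.castSucc =
      TensorProduct.map LinearMap.id (tauT t i) ∘ₗ gatherP k i.succ ∘ₗ
        (affineStep q t i.succ : P n τ →ₗ[ℝ] P n τ) from DFunLike.congr_fun e f
  refine TensorProduct.ext' fun p v => ?_
  have h' : k ≤ i.succ := h.trans Fin.castSucc_lt_succ.le
  have e₁ : gather k i.castSucc (rot q i.castSucc p) = gather k i.succ (rot q i.succ p) :=
    DFunLike.congr_fun ((gather_comp_rot q h).trans (gather_comp_rot q h').symm) p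
  simp [gatherP, affineStep, sigma_castSucc, e₁, h.not_gt, h'.not_gt]

theorem killP_affineStep_killP (q t : ℝ) (k : Fin (n + 1)) (f : P n τ) :
    killP ((k : ℕ) + 1) (affineStep q t k f) = affineStep q t k (killP ((k : ℕ) + 1) f) := by
  suffices e : killP ((k : ℕ) + 1) ∘ₗ affineStep q t k =
      affineStep q t k ∘ₗ (killP ((k : ℕ) + 1) : P n τ →ₗ[ℝ] P n τ) from DFunLike.congr_fun e f
  refine TensorProduct.ext' fun p v => ?_
  have e₁ : (kill ((k : ℕ) + 1)).comp (rot q k) = (rot q k).comp (kill ((k : ℕ) + 1)) := by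
    apply MvPolynomial.algHom_ext
    intro m
    refine Fin.cases ?_ (fun m => ?_) m
    · simp
    · rcases lt_or_ge m.castSucc k with h | h
      · have h' : (m : ℕ) < k := h
        simp [Fin.succAbove_of_castSucc_lt _ _ h, h', h'.trans (Nat.lt_succ_self _)]
      · have h' : ¬ (m : ℕ) < k := not_lt.2 h
        simp [Fin.succAbove_of_le_castSucc _ _ h, h']
  have e₂ := DFunLike.congr_fun e₁ p
  simp only [AlgHom.comp_apply] at e₂
  simp [killP, affineStep, e₂]

theorem killP_affineStep (q t : ℝ) (k : Fin (n + 1)) (f : P n τ) :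
    killP k (affineStep q t k f) = 0 := by
  suffices e : killP k ∘ₗ affineStep q t k = (0 : P n τ →ₗ[ℝ] P n τ) from DFunLike.congr_fun e f
  exact TensorProduct.ext' fun p v => by simp [killP, affineStep]

theorem macdonald_insertComp_last (q t : ℝ) (S : RSYT n τ) (γ : Fin (n + 1) → ℕ) :
    macdonald q t S (insertComp (Fin.last n) γ) =
      affineStep q t (Fin.last n) (macdonald q t S γ) := by
  rw [macdonald, dif_pos (by simp), phiInv_insertComp_last, affineStep_last]

theorem max'_descents_insertComp {k : Fin (n + 1)} (i : Fin n) (hk : k ≤ i.castSucc)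
    (γ : Fin (n + 1) → ℕ) (hγ : ∀ m, k < m → γ m = 0)
    (hd : (descents (insertComp i.castSucc γ)).Nonempty) :
    (descents (insertComp i.castSucc γ)).max' hd = i := by
  have hz := insertComp_eq_zero k i.castSucc hk γ hγ
  apply le_antisymm
  · refine Finset.max'_le _ _ _ fun m hm => ?_
    simp only [descents, Finset.mem_filter, Finset.mem_univ, true_and] at hm
    by_contra! hlt
    rw [hz m.castSucc (Fin.castSucc_lt_castSucc_iff.2 hlt)] at hm
    omega
  · apply Finset.le_max'
    simp [descents, hz i.succ Fin.castSucc_lt_succ]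

/-- `i` is the last descent of `insertComp i.castSucc γ`, so this is one step of the Yang-Baxter
graph. -/
theorem macdonald_insertComp_castSucc (q t : ℝ) (S : RSYT n τ) {k : Fin (n + 1)} (i : Fin n)
    (hk : k ≤ i.castSucc) (γ : Fin (n + 1) → ℕ) (hγ : ∀ m, k < m → γ m = 0) :
    ∃ c : ℝ, macdonald q t S (insertComp i.castSucc γ) =
      bT t i (macdonald q t S (insertComp i.succ γ)) +
        c • macdonald q t S (insertComp i.succ γ) := by
  have hz := insertComp_eq_zero k i.castSucc hk γ hγ
  have hd : (descents (insertComp i.castSucc γ)).Nonempty :=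
    ⟨i, by simp [descents, hz i.succ Fin.castSucc_lt_succ]⟩
  have hlast : ¬ 1 ≤ insertComp i.castSucc γ (Fin.last n) := by
    rw [hz _ (Fin.castSucc_lt_last i)]
    omega
  have e := macdonald.eq_def q t S (insertComp i.castSucc γ)
  rw [dif_neg hlast, dif_pos hd] at e
  simp only [max'_descents_insertComp i hk γ hγ hd, swapComp_insertComp] at e
  exact ⟨_, e⟩

/-- The polynomials along the path `insertComp j γ`, `j = N, …, k`, in which the last nonzero entry
moves down, agree with the affine step at `j` once the variables other than `x_j` from position `k`
on are set to zero. -/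
theorem gatherP_macdonald_insertComp (q t : ℝ) (S : RSYT n τ) (j : Fin (n + 1)) :
    ∀ k ≤ j, ∀ γ : Fin (n + 1) → ℕ, (∀ m, k < m → γ m = 0) →
      gatherP k j (macdonald q t S (insertComp j γ)) =
        gatherP k j (affineStep q t j (macdonald q t S γ)) := by
  refine Fin.reverseInduction ?_ (fun i ih => ?_) j
  · intro k _ γ _
    rw [macdonald_insertComp_last]
  · intro k hk γ hγ
    have hlt : i.castSucc < i.succ := Fin.castSucc_lt_succ
    -- The polynomial one step earlier lies in the ideal generated by the variables beyond `i`.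
    have hzero : gatherP k i.castSucc (macdonald q t S (insertComp i.succ γ)) = 0 := by
      have h₁ := ih i.succ le_rfl γ (fun m hm => hγ m (hk.trans_lt (hlt.trans hm)))
      rw [gatherP, gather_self, ← killP] at h₁
      have h₂ := congrArg (gatherP k i.castSucc) h₁
      have hl : (i.castSucc : ℕ) < (i.succ : ℕ) + 1 := by simp
      rw [gatherP_killP hk hl, gatherP_killP hk hl] at h₂
      rw [h₂, ← gatherP_killP hk (l := (i.succ : ℕ)) (by simp), killP_affineStep, map_zero]
    obtain ⟨c, hc⟩ := macdonald_insertComp_castSucc q t S i hk γ hγ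
    rw [hc, map_add, map_smul, hzero, smul_zero, add_zero, gatherP_bT t i hk,
      ih k (hk.trans hlt.le) γ hγ, ← gatherP_affineStep_castSucc q t i hk]

/-- If `k` is the last nonzero position of a composition, then modulo the variables beyond `k` the
Macdonald polynomial is obtained by an affine step at `k` from one of lower degree. -/
theorem killP_macdonald_insertComp (q t : ℝ) (S : RSYT n τ) (k : Fin (n + 1))
    (γ : Fin (n + 1) → ℕ) (hγ : ∀ m, k < m → γ m = 0) :
    killP ((k : ℕ) + 1) (macdonald q t S (insertComp k γ)) =
      affineStep q t k (killP ((k : ℕ) + 1) (macdonald q t S γ)) := by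
  have h := gatherP_macdonald_insertComp q t S k k le_rfl γ hγ
  rw [gatherP, gather_self, ← killP, killP_affineStep_killP] at h
  exact h

theorem macdonald_zero (q t : ℝ) (S : RSYT n τ) (α : Fin (n + 1) → ℕ) (hα : ∀ m, α m = 0) :
    macdonald q t S α = 1 ⊗ₜ[ℝ] Finsupp.single S 1 := by
  rw [macdonald, dif_neg (by simp [hα]), dif_neg]
  simp [descents, hα]

end Leading

/-! ### Linear independence -/

section Independence

variable {n : ℕ} {τ : YoungDiagram}

theorem killP_linearCombination_insertComp (q t : ℝ) (k : Fin (n + 1))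
    (c : (Fin (n + 1) → ℕ) × RSYT n τ →₀ ℝ) (hc : ∀ p ∈ c.support, ∀ m, k < m → p.1 m = 0) :
    killP ((k : ℕ) + 1) (Finsupp.linearCombination ℝ (macdonaldFamily n τ q t)
        (c.mapDomain (Prod.map (insertComp k) id))) =
      affineStep q t k (killP ((k : ℕ) + 1)
        (Finsupp.linearCombination ℝ (macdonaldFamily n τ q t) c)) := by
  rw [Finsupp.linearCombination_mapDomain, Finsupp.linearCombination_apply,
    Finsupp.linearCombination_apply, Finsupp.sum, Finsupp.sum]
  simp only [map_sum, map_smul]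
  refine Finset.sum_congr rfl fun p hp => ?_
  exact congrArg (c p • ·) (killP_macdonald_insertComp q t p.2 k p.1 (hc p hp))

/-- Modulo the variables from position `k` on, the Macdonald polynomials indexed by compositions
that vanish from position `k` on are linearly independent.  Coefficients of compositions with a
zero at the last admissible position are removed by killing one more variable, the others by
undoing an affine step. -/
theorem eq_zero_of_killP_linearCombination {q t : ℝ} (hq : q ≠ 0) (ht : 0 < t) (ht1 : t ≠ 1)
    (d : ℕ) : ∀ k ≤ n + 1, ∀ c : (Fin (n + 1) → ℕ) × RSYT n τ →₀ ℝ,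
      (∀ p ∈ c.support, (∀ m : Fin (n + 1), k ≤ (m : ℕ) → p.1 m = 0) ∧ ∑ m, p.1 m ≤ d) →
      killP k (Finsupp.linearCombination ℝ (macdonaldFamily n τ q t) c) = 0 → c = 0 := by
  induction d using Nat.strong_induction_on with | _ d ihd
  intro k
  induction k with
  | zero =>
    intro _ c hc h
    have hinj : Function.Injective (fun S : RSYT n τ => ((fun _ => 0 : Fin (n + 1) → ℕ), S)) :=
      fun S S' h => (Prod.ext_iff.1 h).2
    have hmap := Finsupp.mapDomain_comapDomain _ hinj c (fun p hp =>
      ⟨p.2, Prod.ext (funext fun m => ((hc p hp).1 m (Nat.zero_le _)).symm) rfl⟩)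
    rw [← hmap] at h ⊢
    set c' := Finsupp.comapDomain _ c hinj.injOn
    suffices c' = 0 by rw [this, Finsupp.mapDomain_zero]
    have hval : Finsupp.linearCombination ℝ (macdonaldFamily n τ q t)
        (c'.mapDomain fun S : RSYT n τ => ((fun _ => 0 : Fin (n + 1) → ℕ), S)) =
          (1 : MvPolynomial (Fin (n + 1)) ℝ) ⊗ₜ[ℝ] (c' : V n τ) := by
      rw [Finsupp.linearCombination_mapDomain]
      induction c' using Finsupp.induction_linear with
      | zero => simp
      | add f g hf hg => rw [map_add, hf, hg, TensorProduct.tmul_add]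
      | single S a =>
        rw [Finsupp.linearCombination_single, Function.comp_apply, macdonaldFamily,
          macdonald_zero q t S _ (fun _ => rfl), ← TensorProduct.tmul_smul, Finsupp.smul_single,
          smul_eq_mul, mul_one]
    rw [hval] at h
    -- Evaluation of the first tensor factor at the origin recovers the vector.
    have h' := congrArg (TensorProduct.lid ℝ (V n τ) ∘ TensorProduct.map
      (MvPolynomial.aeval (fun _ : Fin (n + 1) => (0 : ℝ))).toLinearMap LinearMap.id) h
    simpa [killP] using h'
  | succ k ih =>
    intro hk c hc h
    let kk : Fin (n + 1) := ⟨k, hk⟩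
    have hkk : ∀ m : Fin (n + 1), kk < m → k + 1 ≤ (m : ℕ) := fun m hm => hm
    have hinj : Function.Injective
        (Prod.map (insertComp kk) id : (Fin (n + 1) → ℕ) × RSYT n τ → _) :=
      (insertComp_injective kk).prodMap Function.injective_id
    -- The part of a combination with `α_k ≠ 0` comes from an affine step.
    have hstep : ∀ c : (Fin (n + 1) → ℕ) × RSYT n τ →₀ ℝ,
        (∀ p ∈ c.support, (∀ m : Fin (n + 1), k + 1 ≤ (m : ℕ) → p.1 m = 0) ∧ ∑ m, p.1 m ≤ d) →
        (∀ p ∈ c.support, p.1 kk ≠ 0) → ∃ c' : (Fin (n + 1) → ℕ) × RSYT n τ →₀ ℝ,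
          c'.mapDomain (Prod.map (insertComp kk) id) = c ∧
          ∀ p ∈ c'.support, (∀ m : Fin (n + 1), k + 1 ≤ (m : ℕ) → p.1 m = 0) ∧
            ∑ m, p.1 m < d := by
      intro c hc hne
      refine ⟨c.comapDomain _ hinj.injOn, Finsupp.mapDomain_comapDomain _ hinj c ?_, ?_⟩
      · intro p hp
        obtain ⟨γ, hγ, _⟩ := exists_insertComp_eq kk p.1
          (fun m hm => (hc p hp).1 m (hkk m hm)) (hne p hp)
        exact ⟨(γ, p.2), Prod.ext hγ rfl⟩
      · intro p hp
        have hp' := hc _ (by simpa using hp : Prod.map (insertComp kk) id p ∈ c.support)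
        have hne' := hne _ (by simpa using hp : Prod.map (insertComp kk) id p ∈ c.support)
        simp only [Prod.map_fst, sum_insertComp] at hp' hne'
        obtain ⟨γ, hγ, hγ0⟩ := exists_insertComp_eq kk _
          (fun m hm => hp'.1 m (hkk m hm)) hne'
        rw [insertComp_injective kk hγ] at hγ0
        exact ⟨fun m hm => hγ0 m hm, hp'.2⟩
    have hsplit := c.filter_add_filter_not (fun p => p.1 kk = 0)
    set c₁ := c.filter (fun p => p.1 kk = 0) with hc₁
    set c₂ := c.filter (fun p => ¬ p.1 kk = 0) with hc₂
    have hs₁ : ∀ p ∈ c₁.support, p ∈ c.support ∧ p.1 kk = 0 := fun p hp => by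
      rwa [hc₁, Finsupp.support_filter, Finset.mem_filter] at hp
    have hs₂ : ∀ p ∈ c₂.support, p ∈ c.support ∧ ¬ p.1 kk = 0 := fun p hp => by
      rwa [hc₂, Finsupp.support_filter, Finset.mem_filter] at hp
    obtain ⟨c', hc', hc's⟩ := hstep c₂ (fun p hp => hc p (hs₂ p hp).1) (fun p hp => (hs₂ p hp).2)
    have h₂ := killP_linearCombination_insertComp q t kk c' (fun p hp m hm => (hc's p hp).1 m hm)
    rw [hc'] at h₂
    have hz₁ : c₁ = 0 := by
      refine ih (by omega) c₁ (fun p hp => ⟨fun m hm => ?_, (hc p (hs₁ p hp).1).2⟩) ?_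
      · rcases hm.eq_or_lt with e | e
        · have : m = kk := Fin.ext e.symm
          rw [this]
          exact (hs₁ p hp).2
        · exact (hc p (hs₁ p hp).1).1 m e
      · have h' := congrArg (killP k) h
        rw [← hsplit, map_add, map_add, h₂, map_add, map_zero, killP_killP (Nat.le_succ k)] at h'
        rwa [show k = (kk : ℕ) from rfl, killP_affineStep, add_zero] at h'
    rw [hz₁, zero_add] at hsplit
    rw [← hsplit] at h ⊢
    have h₃ := h₂.symm.trans h
    rw [map_eq_zero_iff _ (affineStep_injective hq ht ht1 kk)] at h₃
    suffices c' = 0 by rw [← hc', this, Finsupp.mapDomain_zero]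
    rcases Nat.eq_zero_or_pos d with rfl | hd
    · refine Finsupp.support_eq_empty.1 (Finset.eq_empty_of_forall_notMem fun p hp => ?_)
      exact absurd (hc's p hp).2 (Nat.not_lt_zero _)
    · exact ihd (d - 1) (by omega) (k + 1) hk c'
        (fun p hp => ⟨(hc's p hp).1, Nat.le_sub_one_of_lt (hc's p hp).2⟩) h₃

theorem linearIndependent_macdonaldFamily {q t : ℝ} (hq : q ≠ 0) (ht : 0 < t) (ht1 : t ≠ 1) :
    LinearIndependent ℝ (macdonaldFamily n τ q t) := by
  rw [linearIndependent_iff]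
  intro c hc
  refine eq_zero_of_killP_linearCombination hq ht ht1
    (c.support.sup fun p => ∑ m, p.1 m) (n + 1) le_rfl c (fun p hp => ⟨fun m hm => ?_, ?_⟩) ?_
  · exact absurd m.2 (not_lt.2 hm)
  · exact Finset.le_sup (f := fun p : (Fin (n + 1) → ℕ) × RSYT n τ => ∑ m, p.1 m) hp
  · rw [hc, map_zero]

end Independence

/-! ### Spanning -/

section Spanning

variable {n : ℕ} {τ : YoungDiagram}

/-- The monomial `x^μ`. -/
noncomputable def mono (μ : Fin (n + 1) → ℕ) : MvPolynomial (Fin (n + 1)) ℝ :=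
  ∏ j, MvPolynomial.X j ^ μ j

/-- The span of the `x^μ ⊗ v` of degree at most `d` in the variables before position `k`. -/
noncomputable def monoSpan (n : ℕ) (τ : YoungDiagram) (k d : ℕ) : Submodule ℝ (P n τ) :=
  Submodule.span ℝ {f | ∃ (μ : Fin (n + 1) → ℕ) (v : V n τ),
    (∀ m : Fin (n + 1), k ≤ (m : ℕ) → μ m = 0) ∧ ∑ m, μ m ≤ d ∧ mono μ ⊗ₜ[ℝ] v = f}

/-- The span of the Macdonald polynomials of degree at most `d` indexed by compositions that vanish
from position `k` on, taken modulo the variables from position `k` on. -/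
noncomputable def macSpan (n : ℕ) (τ : YoungDiagram) (q t : ℝ) (k d : ℕ) :
    Submodule ℝ (P n τ) :=
  Submodule.span ℝ {f | ∃ (α : Fin (n + 1) → ℕ) (S : RSYT n τ),
    (∀ m : Fin (n + 1), k ≤ (m : ℕ) → α m = 0) ∧ ∑ m, α m ≤ d ∧
      killP k (macdonald q t S α) = f}

theorem mono_tmul_mem {k d : ℕ} {μ : Fin (n + 1) → ℕ} (v : V n τ)
    (hμ : ∀ m : Fin (n + 1), k ≤ (m : ℕ) → μ m = 0) (hd : ∑ m, μ m ≤ d) :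
    mono μ ⊗ₜ[ℝ] v ∈ monoSpan n τ k d :=
  Submodule.subset_span ⟨μ, v, hμ, hd, rfl⟩

theorem tmul_mem_monoSpan {d : ℕ} {p : MvPolynomial (Fin (n + 1)) ℝ} (hp : p.totalDegree ≤ d)
    (v : V n τ) : p ⊗ₜ[ℝ] v ∈ monoSpan n τ (n + 1) d := by
  rw [← MvPolynomial.support_sum_monomial_coeff p, TensorProduct.sum_tmul]
  refine Submodule.sum_mem _ fun s hs => ?_
  have e : MvPolynomial.monomial s (p.coeff s) = p.coeff s • mono s := by
    rw [MvPolynomial.monomial_eq, MvPolynomial.smul_eq_C_mul, mono,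
      Finsupp.prod_fintype _ _ (fun _ => pow_zero _)]
  rw [e, ← TensorProduct.smul_tmul']
  refine Submodule.smul_mem _ _ (mono_tmul_mem v (fun m hm => absurd m.2 (not_lt.2 hm)) ?_)
  have := MvPolynomial.le_totalDegree hs
  rw [Finsupp.sum_fintype _ _ (fun _ => rfl)] at this
  exact this.trans hp

theorem totalDegree_mono_le (μ : Fin (n + 1) → ℕ) : (mono μ).totalDegree ≤ ∑ m, μ m := by
  refine (MvPolynomial.totalDegree_finsetProd _ _).trans (Finset.sum_le_sum fun m _ => ?_)
  rw [MvPolynomial.totalDegree_X_pow]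

theorem totalDegree_X_mul_divDiff_le (i : Fin n) (p : MvPolynomial (Fin (n + 1)) ℝ) :
    (MvPolynomial.X i.succ * divDiff i p).totalDegree ≤ p.totalDegree := by
  rcases eq_or_ne (divDiff i p) 0 with h0 | h0
  · simp [h0]
  have h₁ : (p - swapVars i p).totalDegree ≤ p.totalDegree :=
    (MvPolynomial.totalDegree_sub _ _).trans
      (max_le le_rfl (MvPolynomial.totalDegree_rename_le _ _))
  rw [← mul_divDiff, MvPolynomial.totalDegree_mul_of_isDomain (X_sub_X_ne_zero i) h0] at h₁
  have h₂ : 1 ≤ (MvPolynomial.X i.castSucc - MvPolynomial.X i.succ :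
      MvPolynomial (Fin (n + 1)) ℝ).totalDegree := by
    have hs : Finsupp.single i.castSucc 1 ∈ (MvPolynomial.X i.castSucc - MvPolynomial.X i.succ :
        MvPolynomial (Fin (n + 1)) ℝ).support := by
      have hne : (Finsupp.single i.succ 1 : Fin (n + 1) →₀ ℕ) ≠ Finsupp.single i.castSucc 1 := by
        intro h
        exact (Fin.castSucc_lt_succ (i := i)).ne' (Finsupp.single_left_injective one_ne_zero h)
      rw [MvPolynomial.mem_support_iff, MvPolynomial.coeff_sub, MvPolynomial.coeff_X,
        MvPolynomial.X, MvPolynomial.coeff_monomial, if_neg hne]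
      simp
    simpa using MvPolynomial.le_totalDegree hs
  refine (MvPolynomial.totalDegree_mul _ _).trans ?_
  rw [MvPolynomial.totalDegree_X]
  omega

theorem bT_mem_monoSpan (t : ℝ) (i : Fin n) {d : ℕ} {f : P n τ}
    (hf : f ∈ monoSpan n τ (n + 1) d) : bT t i f ∈ monoSpan n τ (n + 1) d := by
  refine (Submodule.span_le (p := (monoSpan n τ (n + 1) d).comap (bT t i))).2 ?_ hf
  rintro _ ⟨μ, v, -, hd, rfl⟩
  have hμ := (totalDegree_mono_le μ).trans hd
  refine Submodule.add_mem _ (tmul_mem_monoSpan ?_ v) (tmul_mem_monoSpan ?_ _)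
  · exact (MvPolynomial.totalDegree_smul_le _ _).trans ((totalDegree_X_mul_divDiff_le i _).trans hμ)
  · exact (MvPolynomial.totalDegree_rename_le _ _).trans hμ

theorem X_mul_rot_mono (q : ℝ) (k : Fin (n + 1)) (γ : Fin (n + 1) → ℕ) :
    MvPolynomial.X k * rot q k (mono γ) = q ^ γ 0 • mono (insertComp k γ) := by
  rw [mono, mono, map_prod, Fin.prod_univ_succ, Fin.prod_univ_succAbove _ k]
  simp only [map_pow, rot_X_zero, rot_X_succ, insertComp_same, insertComp_succAbove,
    MvPolynomial.smul_eq_C_mul]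
  ring

theorem affineStep_mono_tmul (q t : ℝ) (k : Fin (n + 1)) (γ : Fin (n + 1) → ℕ) (v : V n τ) :
    affineStep q t k (mono γ ⊗ₜ[ℝ] v) = q ^ γ 0 • (mono (insertComp k γ) ⊗ₜ[ℝ] sigma t k v) := by
  rw [affineStep, TensorProduct.map_tmul, LinearMap.comp_apply, LinearMap.mulLeft_apply,
    AlgHom.toLinearMap_apply, X_mul_rot_mono, ← TensorProduct.smul_tmul']

theorem mulXLast_bw_mem_monoSpan (q t : ℝ) {d : ℕ} {f : P n τ}
    (hf : f ∈ monoSpan n τ (n + 1) d) : mulXLast (bw q t f) ∈ monoSpan n τ (n + 1) (d + 1) := by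
  rw [← affineStep_last]
  refine (Submodule.span_le
    (p := (monoSpan n τ (n + 1) (d + 1)).comap (affineStep q t (Fin.last n)))).2 ?_ hf
  rintro _ ⟨μ, v, -, hd, rfl⟩
  rw [SetLike.mem_coe, Submodule.mem_comap, affineStep_mono_tmul]
  refine Submodule.smul_mem _ _ (mono_tmul_mem _ (fun m hm => absurd m.2 (not_lt.2 hm)) ?_)
  rw [sum_insertComp]
  omega

theorem monoSpan_mono (k : ℕ) {d d' : ℕ} (h : d ≤ d') : monoSpan n τ k d ≤ monoSpan n τ k d' :=
  Submodule.span_mono fun _ ⟨μ, v, h₁, h₂, h₃⟩ => ⟨μ, v, h₁, h₂.trans h, h₃⟩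

theorem macSpan_mono (q t : ℝ) (k : ℕ) {d d' : ℕ} (h : d ≤ d') :
    macSpan n τ q t k d ≤ macSpan n τ q t k d' :=
  Submodule.span_mono fun _ ⟨α, S, h₁, h₂, h₃⟩ => ⟨α, S, h₁, h₂.trans h, h₃⟩

theorem macdonald_mem_monoSpan (q t : ℝ) (S : RSYT n τ) (α : Fin (n + 1) → ℕ) :
    macdonald q t S α ∈ monoSpan n τ (n + 1) (∑ m, α m) := by
  induction α using macdonald.induct with
  | case1 α hN ih =>
    rw [macdonald, dif_pos hN]
    exact monoSpan_mono _ (sum_phiInv_lt α hN) (mulXLast_bw_mem_monoSpan q t ih)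
  | case2 α hN hd i β ih =>
    have e : ∑ m, β m = ∑ m, α m := sum_swapComp α i
    rw [e] at ih
    rw [macdonald, dif_neg hN, dif_pos hd]
    exact Submodule.add_mem _ (bT_mem_monoSpan t i ih) (Submodule.smul_mem _ _ ih)
  | case3 α hN hd =>
    rw [macdonald, dif_neg hN, dif_neg hd]
    exact tmul_mem_monoSpan (by simp) _

theorem kill_mono_of_vanish {k : ℕ} {μ : Fin (n + 1) → ℕ}
    (hμ : ∀ m : Fin (n + 1), k ≤ (m : ℕ) → μ m = 0) : kill k (mono μ) = mono μ := by
  rw [mono, map_prod]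
  refine Finset.prod_congr rfl fun m _ => ?_
  rw [map_pow, kill_X]
  split_ifs with h
  · rfl
  · rw [hμ m (not_lt.1 h), pow_zero, pow_zero]

theorem kill_mono_of_ne_zero {k : ℕ} {μ : Fin (n + 1) → ℕ} {m : Fin (n + 1)} (hk : k ≤ (m : ℕ))
    (hm : μ m ≠ 0) : kill k (mono μ) = 0 := by
  rw [mono, map_prod]
  refine Finset.prod_eq_zero (Finset.mem_univ m) ?_
  rw [map_pow, kill_X, if_neg (not_lt.2 hk), zero_pow hm]

theorem killP_mem_monoSpan (k : ℕ) {d : ℕ} {f : P n τ} (hf : f ∈ monoSpan n τ (n + 1) d) :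
    killP k f ∈ monoSpan n τ k d := by
  refine (Submodule.span_le (p := (monoSpan n τ k d).comap (killP k))).2 ?_ hf
  rintro _ ⟨μ, v, -, hd, rfl⟩
  rw [SetLike.mem_coe, Submodule.mem_comap, killP, TensorProduct.map_tmul,
    AlgHom.toLinearMap_apply]
  by_cases h : ∀ m : Fin (n + 1), k ≤ (m : ℕ) → μ m = 0
  · rw [kill_mono_of_vanish h]
    exact mono_tmul_mem _ h hd
  · push Not at h
    obtain ⟨m, hm, hμ⟩ := h
    rw [kill_mono_of_ne_zero hm hμ, TensorProduct.zero_tmul]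
    exact Submodule.zero_mem _

theorem affineStep_mem_macSpan (q t : ℝ) (k : Fin (n + 1)) {d : ℕ} {f : P n τ}
    (hf : f ∈ macSpan n τ q t ((k : ℕ) + 1) d) :
    affineStep q t k f ∈ macSpan n τ q t ((k : ℕ) + 1) (d + 1) := by
  refine (Submodule.span_le
    (p := (macSpan n τ q t ((k : ℕ) + 1) (d + 1)).comap (affineStep q t k))).2 ?_ hf
  rintro _ ⟨γ, S, hγ, hd, rfl⟩
  refine Submodule.subset_span ⟨insertComp k γ, S, ?_, ?_,
    killP_macdonald_insertComp q t S k γ fun m hm => hγ m hm⟩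
  · exact fun m hm => insertComp_eq_zero k k le_rfl γ (fun m hm => hγ m hm) m hm
  · rw [sum_insertComp]
    omega

/-- Modulo the variables from position `k` on, the Macdonald polynomials indexed by compositions
that vanish from position `k` on span all polynomials in the variables before position `k`: the
monomials divisible by the last admissible variable are reached by an affine step, and the others
up to such monomials by induction on `k`. -/
theorem monoSpan_le_macSpan {q t : ℝ} (hq : q ≠ 0) (ht : 0 < t) (ht1 : t ≠ 1) (d : ℕ) :
    ∀ k ≤ n + 1, monoSpan n τ k d ≤ macSpan n τ q t k d := by
  induction d using Nat.strong_induction_on with | _ d ihd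
  intro k
  induction k with
  | zero =>
    intro _
    refine Submodule.span_le.2 ?_
    rintro _ ⟨μ, v, hμ, -, rfl⟩
    have e : mono μ = 1 := by
      rw [mono]
      exact Finset.prod_eq_one fun m _ => by rw [hμ m (Nat.zero_le _), pow_zero]
    rw [e]
    induction v using Finsupp.induction_linear with
    | zero => rw [TensorProduct.tmul_zero]; exact Submodule.zero_mem _
    | add f g hf hg => rw [TensorProduct.tmul_add]; exact Submodule.add_mem _ hf hg
    | single S a =>
      have es : (Finsupp.single S a : V n τ) = a • Finsupp.single S 1 := by simp
      rw [es, TensorProduct.tmul_smul]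
      refine Submodule.smul_mem _ _ (Submodule.subset_span ⟨fun _ => 0, S, fun _ _ => rfl, ?_, ?_⟩)
      · simp
      · rw [macdonald_zero q t S _ fun _ => rfl]
        simp [killP]
  | succ k ih =>
    intro hk
    let kk : Fin (n + 1) := ⟨k, hk⟩
    have hdiv : ∀ (μ : Fin (n + 1) → ℕ) (v : V n τ),
        (∀ m : Fin (n + 1), k + 1 ≤ (m : ℕ) → μ m = 0) → ∑ m, μ m ≤ d → μ kk ≠ 0 →
          mono μ ⊗ₜ[ℝ] v ∈ macSpan n τ q t (k + 1) d := by
      intro μ v hμ hd hne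
      obtain ⟨γ, rfl, hγ⟩ := exists_insertComp_eq kk μ (fun m hm => hμ m hm) hne
      obtain ⟨w, rfl⟩ := (sigma_bijective ht ht1 kk).2 v
      rw [sum_insertComp] at hd
      have h₁ : mono γ ⊗ₜ[ℝ] w ∈ macSpan n τ q t (k + 1) (∑ m, γ m) :=
        ihd _ (by omega) (k + 1) hk (mono_tmul_mem w (fun m hm => hγ m hm) le_rfl)
      have h₂ := macSpan_mono q t _ hd (affineStep_mem_macSpan q t kk h₁)
      rw [affineStep_mono_tmul] at h₂
      exact (Submodule.smul_mem_iff _ (pow_ne_zero _ hq)).1 h₂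
    have hsub : ∀ g ∈ monoSpan n τ (k + 1) d, g - killP k g ∈ macSpan n τ q t (k + 1) d := by
      intro g hg
      refine (Submodule.span_le
        (p := (macSpan n τ q t (k + 1) d).comap (LinearMap.id - killP k))).2 ?_ hg
      rintro _ ⟨μ, v, hμ, hd, rfl⟩
      rw [SetLike.mem_coe, Submodule.mem_comap, LinearMap.sub_apply, LinearMap.id_apply, killP,
        TensorProduct.map_tmul, AlgHom.toLinearMap_apply, LinearMap.id_apply]
      by_cases h : μ kk = 0
      · rw [kill_mono_of_vanish, sub_self]
        · exact Submodule.zero_mem _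
        · intro m hm
          rcases hm.eq_or_lt with e | e
          · rw [show m = kk from Fin.ext e.symm, h]
          · exact hμ m e
      · rw [kill_mono_of_ne_zero (m := kk) le_rfl h, TensorProduct.zero_tmul, sub_zero]
        exact hdiv μ v hμ hd h
    have hle : macSpan n τ q t k d ≤ macSpan n τ q t (k + 1) d := by
      refine Submodule.span_le.2 ?_
      rintro _ ⟨α, S, hα, hd, rfl⟩
      have h₁ : killP (k + 1) (macdonald q t S α) ∈ macSpan n τ q t (k + 1) d :=
        Submodule.subset_span ⟨α, S, fun m hm => hα m (by omega), hd, rfl⟩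
      have h₂ := hsub _ (killP_mem_monoSpan (k + 1)
        (monoSpan_mono _ hd (macdonald_mem_monoSpan q t S α)))
      rw [killP_killP (Nat.le_succ k)] at h₂
      simpa using Submodule.sub_mem _ h₁ h₂
    refine Submodule.span_le.2 ?_
    rintro _ ⟨μ, v, hμ, hd, rfl⟩
    by_cases h : μ kk = 0
    · refine hle (ih (by omega) (mono_tmul_mem v (fun m hm => ?_) hd))
      rcases hm.eq_or_lt with e | e
      · rw [show m = kk from Fin.ext e.symm, h]
      · exact hμ m e
    · exact hdiv μ v hμ hd h

theorem span_macdonaldFamily {q t : ℝ} (hq : q ≠ 0) (ht : 0 < t) (ht1 : t ≠ 1) :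
    Submodule.span ℝ (Set.range (macdonaldFamily n τ q t)) = ⊤ := by
  refine eq_top_iff.2 fun f _ => ?_
  induction f using TensorProduct.induction_on with
  | zero => exact Submodule.zero_mem _
  | add f g hf hg => exact Submodule.add_mem _ (hf trivial) (hg trivial)
  | tmul p v =>
    refine (monoSpan_le_macSpan hq ht ht1 p.totalDegree (n + 1) le_rfl).trans ?_
      (tmul_mem_monoSpan le_rfl v)
    refine Submodule.span_mono ?_
    rintro _ ⟨α, S, -, -, rfl⟩
    exact ⟨(α, S), (killP_of_lt (Nat.lt_succ_self n) _).symm⟩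

end Spanning

/-! ### The region of parameters -/

section Region

theorem maxHook_pos {τ : YoungDiagram} (hτ : 0 < τ.card) : 0 < maxHook τ := by
  obtain ⟨⟨i, j⟩, hc⟩ := Finset.card_pos.1 hτ
  have h : ((0 : ℕ), (0 : ℕ)) ∈ τ := τ.up_left_mem (Nat.zero_le i) (Nat.zero_le j) hc
  have h₁ := τ.mem_iff_lt_rowLen.1 h
  have h₂ := τ.mem_iff_lt_colLen.1 h
  rw [maxHook]
  omega

/-- Both descriptions of the region say that `h |log t| < |log q|`. -/
theorem region_iff {q t : ℝ} (hq : 0 < q) (ht : 0 < t) {h : ℕ} (hh : 0 < h) :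
    (q < min (t ^ (-(h : ℤ))) (t ^ (h : ℤ)) ∨ max (t ^ (-(h : ℤ))) (t ^ (h : ℤ)) < q) ↔
      (min (q ^ (-(1 / (h : ℝ)))) (q ^ (1 / (h : ℝ))) < t ∧
        t < max (q ^ (-(1 / (h : ℝ)))) (q ^ (1 / (h : ℝ)))) := by
  have hh' : (0 : ℝ) < h := Nat.cast_pos.2 hh
  have e₁ : ∀ m : ℤ, q < t ^ m ↔ Real.log q < m * Real.log t := fun m => by
    rw [← Real.log_zpow, Real.log_lt_log_iff hq (zpow_pos ht m)]
  have e₂ : ∀ m : ℤ, t ^ m < q ↔ m * Real.log t < Real.log q := fun m => by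
    rw [← Real.log_zpow, Real.log_lt_log_iff (zpow_pos ht m) hq]
  have e₃ : ∀ r : ℝ, q ^ (r / h) < t ↔ r * Real.log q < h * Real.log t := fun r => by
    rw [← Real.log_lt_log_iff (Real.rpow_pos_of_pos hq _) ht, Real.log_rpow hq, div_mul_eq_mul_div,
      div_lt_iff₀ hh', mul_comm (Real.log t)]
  have e₄ : ∀ r : ℝ, t < q ^ (r / h) ↔ h * Real.log t < r * Real.log q := fun r => by
    rw [← Real.log_lt_log_iff ht (Real.rpow_pos_of_pos hq _), Real.log_rpow hq, div_mul_eq_mul_div,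
      lt_div_iff₀ hh', mul_comm (Real.log t)]
  rw [lt_min_iff, max_lt_iff, min_lt_iff, lt_max_iff, e₁, e₁, e₂, e₂, ← neg_div, e₃, e₃, e₄, e₄]
  push_cast
  set x := (h : ℝ) * Real.log t
  rw [neg_mul, neg_mul, one_mul]
  constructor
  · rintro (⟨h₁, h₂⟩ | ⟨h₁, h₂⟩)
    · exact ⟨Or.inr h₂, Or.inl (by linarith)⟩
    · exact ⟨Or.inl (by linarith), Or.inr h₂⟩
  · rintro ⟨h₁ | h₁, h₂ | h₂⟩
    · linarith
    · exact Or.inr ⟨by linarith, by linarith⟩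
    · exact Or.inl ⟨by linarith, by linarith⟩
    · linarith

theorem min_zpow_le_zpow {t : ℝ} (ht : 0 < t) {h m : ℤ} (hm : |m| ≤ h) :
    min (t ^ (-h)) (t ^ h) ≤ t ^ m := by
  rw [abs_le] at hm
  rcases le_total t 1 with h₁ | h₁
  · exact (min_le_right _ _).trans (zpow_le_zpow_right_of_le_one₀ ht h₁ hm.2)
  · exact (min_le_left _ _).trans (zpow_le_zpow_right₀ h₁ hm.1)

theorem zpow_le_max_zpow {t : ℝ} (ht : 0 < t) {h m : ℤ} (hm : |m| ≤ h) :
    t ^ m ≤ max (t ^ (-h)) (t ^ h) := by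
  rw [abs_le] at hm
  rcases le_total t 1 with h₁ | h₁
  · exact (zpow_le_zpow_right_of_le_one₀ ht h₁ hm.1).trans (le_max_left _ _)
  · exact (zpow_le_zpow_right₀ h₁ hm.2).trans (le_max_right _ _)

/-- Within the region, every factor `1 - q^{l+1} t^m` with `|m| ≤ h` has the sign of `1 - q`. -/
theorem one_sub_mul_pos {q t : ℝ} (hq : 0 < q) (ht : 0 < t) {h : ℕ}
    (hr : q < min (t ^ (-(h : ℤ))) (t ^ (h : ℤ)) ∨ max (t ^ (-(h : ℤ))) (t ^ (h : ℤ)) < q)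
    {m : ℤ} (hm : |m| ≤ h) (l : ℕ) : 0 < (1 - q) * (1 - q ^ (l + 1) * t ^ m) := by
  have hm' : |-m| ≤ h := by rwa [abs_neg]
  have h0 : |(0 : ℤ)| ≤ h := by simp
  have hpos := zpow_pos ht m
  have e : q ^ (l + 1) * t ^ m = q ^ l * (q * t ^ m) := by ring
  have e' : t ^ (-m) * t ^ m = 1 := by rw [zpow_neg, inv_mul_cancel₀ hpos.ne']
  rw [e]
  rcases hr with hr | hr
  · have h₁ : q < 1 := by simpa using hr.trans_le (min_zpow_le_zpow ht h0)
    have h₂ : q * t ^ m < 1 := by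
      rw [← e']
      exact mul_lt_mul_of_pos_right (hr.trans_le (min_zpow_le_zpow ht hm')) hpos
    have h₃ : q ^ l * (q * t ^ m) < 1 :=
      (mul_le_of_le_one_left (by positivity) (pow_le_one₀ hq.le h₁.le)).trans_lt h₂
    exact mul_pos (sub_pos.2 h₁) (sub_pos.2 h₃)
  · have h₁ : 1 < q := by simpa using (zpow_le_max_zpow ht h0).trans_lt hr
    have h₂ : 1 < q * t ^ m := by
      rw [← e']
      exact mul_lt_mul_of_pos_right ((zpow_le_max_zpow ht hm').trans_lt hr) hpos
    have h₃ : 1 < q ^ l * (q * t ^ m) :=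
      h₂.trans_le (le_mul_of_one_le_left (by positivity) (one_le_pow₀ h₁.le))
    exact mul_pos_of_neg_of_neg (sub_neg.2 h₁) (sub_neg.2 h₃)

end Region

/-! ### Positivity of the norms -/

section Positivity

variable {n : ℕ} {τ : YoungDiagram}

theorem mul_pos_of_mul_pos_mul_pos {a b c : ℝ} (hb : 0 < a * b) (hc : 0 < a * c) : 0 < b * c := by
  rcases pos_and_pos_or_neg_and_neg_of_mul_pos hb with ⟨ha, hb⟩ | ⟨ha, hb⟩
  · exact mul_pos hb ((pos_iff_pos_of_mul_pos hc).1 ha)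
  · exact mul_pos_of_neg_of_neg hb ((neg_iff_neg_of_mul_pos hc).1 ha)

theorem normSqTableau_pos {t : ℝ} (ht : 0 < t) (ht1 : t ≠ 1) (S : RSYT n τ) :
    0 < normSqTableau t S := by
  refine Finset.prod_pos fun p hp => ?_
  simp only [Finset.mem_filter, Finset.mem_univ, true_and] at hp
  set e := S.content p.1 - S.content p.2 with he
  have he2 : e ≤ -2 := by omega
  rw [u, ← zpow_add_one₀ ht.ne']
  -- For `z = t ^ e` both `t - z` and `1 - z t` have the sign of `t - 1`.
  rcases lt_or_gt_of_ne ht1 with h | h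
  · have h₁ : 1 < t ^ e := one_lt_zpow_of_neg₀ ht h (by omega)
    have h₂ : 1 < t ^ (e + 1) := one_lt_zpow_of_neg₀ ht h (by omega)
    exact div_pos (mul_pos_of_neg_of_neg (by linarith) (by linarith))
      (sq_pos_of_ne_zero (by linarith))
  · have h₁ : t ^ e < 1 := zpow_lt_one_of_neg₀ h (by omega)
    have h₂ : t ^ (e + 1) < 1 := zpow_lt_one_of_neg₀ h (by omega)
    exact div_pos (mul_pos (by linarith) (by linarith)) (pow_pos (by linarith) 2)

theorem pow_mul_qPoch_pos {q t : ℝ} (hq : 0 < q) (ht : 0 < t) {h : ℕ}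
    (hr : q < min (t ^ (-(h : ℤ))) (t ^ (h : ℤ)) ∨ max (t ^ (-(h : ℤ))) (t ^ (h : ℤ)) < q)
    {m : ℤ} (hm : |m| ≤ h) (k : ℕ) : 0 < (1 - q) ^ k * qPoch q (q * t ^ m) k := by
  rw [qPoch, ← Finset.card_range k, ← Finset.prod_const, Finset.card_range,
    ← Finset.prod_mul_distrib]
  refine Finset.prod_pos fun l _ => ?_
  have := one_sub_mul_pos hq ht hr hm l
  rwa [show q * t ^ m * q ^ l = q ^ (l + 1) * t ^ m by ring]

/-- For `z = q^a t^c` the numerator of `u(z)` is `t (1 - q^a t^{c-1}) (1 - q^a t^{c+1})`. -/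
theorem prodE_pos {q t : ℝ} (hq : 0 < q) (ht : 0 < t)
    (hr : q < min (t ^ (-(maxHook τ : ℤ))) (t ^ (maxHook τ : ℤ)) ∨
      max (t ^ (-(maxHook τ : ℤ))) (t ^ (maxHook τ : ℤ)) < q)
    (α : Fin (n + 1) → ℕ) (S : RSYT n τ) : 0 < prodE q t α S := by
  refine Finset.prod_pos fun p hp => ?_
  simp only [Finset.mem_filter, Finset.mem_univ, true_and] at hp
  obtain ⟨l, hl⟩ : ∃ l, α p.2 - α p.1 = l + 1 := ⟨α p.2 - α p.1 - 1, by omega⟩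
  have hb := abs_lt.1 (S.abs_content_sub_lt (rank α p.2) (rank α p.1))
  rw [hl]
  set c := S.content (rank α p.2) - S.content (rank α p.1)
  have h₁ := one_sub_mul_pos hq ht hr (m := c - 1) (abs_le.2 ⟨by omega, by omega⟩) l
  have h₂ := one_sub_mul_pos hq ht hr (m := c + 1) (abs_le.2 ⟨by omega, by omega⟩) l
  have h₃ := one_sub_mul_pos hq ht hr (m := c) (abs_le.2 ⟨by omega, by omega⟩) l
  rw [u, show t - q ^ (l + 1) * t ^ c = t * (1 - q ^ (l + 1) * t ^ (c - 1)) by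
      rw [zpow_sub_one₀ ht.ne']; field_simp,
    show q ^ (l + 1) * t ^ c * t = q ^ (l + 1) * t ^ (c + 1) by rw [zpow_add_one₀ ht.ne']; ring,
    mul_assoc]
  exact div_pos (mul_pos ht (mul_pos_of_mul_pos_mul_pos h₁ h₂))
    (sq_pos_of_ne_zero (right_ne_zero_of_mul h₃.ne'))

theorem normSqPartition_pos {q t : ℝ} (hq : 0 < q) (ht : 0 < t) (ht1 : t ≠ 1)
    (hr : q < min (t ^ (-(maxHook τ : ℤ))) (t ^ (maxHook τ : ℤ)) ∨
      max (t ^ (-(maxHook τ : ℤ))) (t ^ (maxHook τ : ℤ)) < q)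
    (l : Fin (n + 1) → ℕ) (S : RSYT n τ) : 0 < normSqPartition q t l S := by
  rw [normSqPartition, mul_assoc (t ^ kExp l * normSqTableau t S)]
  refine mul_pos (mul_pos (mul_pos (zpow_pos ht _) (normSqTableau_pos ht ht1 S)) ?_) ?_
  -- The power of `1 - q` supplies one factor for each factor of the shifted factorials.
  · have h : 0 < (1 - q) ^ (∑ i, l i) * ∏ i, qPoch q (q * t ^ S.content i) (l i) := by
      rw [← Finset.prod_pow_eq_pow_sum, ← Finset.prod_mul_distrib]
      exact Finset.prod_pos fun i _ => pow_mul_qPoch_pos hq ht hr (S.abs_content_lt i).le _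
    refine mul_pos_of_mul_pos_mul_pos ?_ h
    rw [mul_inv_cancel₀ (left_ne_zero_of_mul h.ne')]
    exact one_pos
  -- The two shifted factorials in the numerator have equally many factors, all of the same sign.
  · refine Finset.prod_pos fun p _ => ?_
    have hb := abs_lt.1 (S.abs_content_sub_lt p.1 p.2)
    set c := S.content p.1 - S.content p.2
    have h₁ := pow_mul_qPoch_pos hq ht hr (m := c - 1) (abs_le.2 ⟨by omega, by omega⟩)
      (l p.1 - l p.2)
    have h₂ := pow_mul_qPoch_pos hq ht hr (m := c + 1) (abs_le.2 ⟨by omega, by omega⟩)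
      (l p.1 - l p.2)
    have h₃ := pow_mul_qPoch_pos hq ht hr (m := c) (abs_le.2 ⟨by omega, by omega⟩)
      (l p.1 - l p.2)
    exact div_pos (mul_pos_of_mul_pos_mul_pos h₁ h₂)
      (sq_pos_of_ne_zero (right_ne_zero_of_mul h₃.ne'))

theorem normSq_pos {q t : ℝ} (hq : 0 < q) (ht : 0 < t) (ht1 : t ≠ 1)
    (hr : q < min (t ^ (-(maxHook τ : ℤ))) (t ^ (maxHook τ : ℤ)) ∨
      max (t ^ (-(maxHook τ : ℤ))) (t ^ (maxHook τ : ℤ)) < q)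
    (α : Fin (n + 1) → ℕ) (S : RSYT n τ) : 0 < normSq q t α S :=
  mul_pos (inv_pos.2 (prodE_pos hq ht hr α S)) (normSqPartition_pos hq ht ht1 hr _ S)

end Positivity

/-! ### The form -/

section Form

variable {n : ℕ} {τ : YoungDiagram} {q t : ℝ}

theorem form_apply (h₁ : LinearIndependent ℝ (macdonaldFamily n τ q t))
    (h₂ : ⊤ ≤ Submodule.span ℝ (Set.range (macdonaldFamily n τ q t))) (f g : P n τ) :
    form n τ q t f g = ((Module.Basis.mk h₁ h₂).repr f).sum fun p a =>
      a * (normSq q t p.1 p.2 * (Module.Basis.mk h₁ h₂).repr g p) := by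
  rw [form, dif_pos ⟨h₁, h₂⟩, Module.Basis.constr_apply, Finsupp.sum, LinearMap.sum_apply]
  rfl

theorem form_macdonald (h₁ : LinearIndependent ℝ (macdonaldFamily n τ q t))
    (h₂ : ⊤ ≤ Submodule.span ℝ (Set.range (macdonaldFamily n τ q t)))
    (p : (Fin (n + 1) → ℕ) × RSYT n τ) (g : P n τ) :
    form n τ q t (macdonald q t p.2 p.1) g =
      normSq q t p.1 p.2 * (Module.Basis.mk h₁ h₂).repr g p := by
  have e : macdonald q t p.2 p.1 = Module.Basis.mk h₁ h₂ p := by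
    rw [Module.Basis.mk_apply]
    rfl
  rw [form_apply h₁ h₂, e, Module.Basis.repr_self, Finsupp.sum_single_index (zero_mul _), one_mul]

theorem form_macdonald_self (h₁ : LinearIndependent ℝ (macdonaldFamily n τ q t))
    (h₂ : ⊤ ≤ Submodule.span ℝ (Set.range (macdonaldFamily n τ q t)))
    (α : Fin (n + 1) → ℕ) (S : RSYT n τ) :
    form n τ q t (macdonald q t S α) (macdonald q t S α) = normSq q t α S := by
  have e : macdonald q t S α = Module.Basis.mk h₁ h₂ (α, S) := by
    rw [Module.Basis.mk_apply]
    rfl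
  rw [form_macdonald h₁ h₂ (α, S), e, Module.Basis.repr_self, Finsupp.single_eq_same, mul_one]

theorem form_macdonald_of_ne (h₁ : LinearIndependent ℝ (macdonaldFamily n τ q t))
    (h₂ : ⊤ ≤ Submodule.span ℝ (Set.range (macdonaldFamily n τ q t)))
    (α β : Fin (n + 1) → ℕ) (S S' : RSYT n τ) (h : (α, S) ≠ (β, S')) :
    form n τ q t (macdonald q t S α) (macdonald q t S' β) = 0 := by
  have e : macdonald q t S' β = Module.Basis.mk h₁ h₂ (β, S') := by
    rw [Module.Basis.mk_apply]
    rfl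
  rw [form_macdonald h₁ h₂ (α, S), e, Module.Basis.repr_self, Finsupp.single_eq_of_ne h, mul_zero]

theorem form_comm (h₁ : LinearIndependent ℝ (macdonaldFamily n τ q t))
    (h₂ : ⊤ ≤ Submodule.span ℝ (Set.range (macdonaldFamily n τ q t))) (f g : P n τ) :
    form n τ q t f g = form n τ q t g f := by
  suffices h : form n τ q t = (form n τ q t).flip from
    DFunLike.congr_fun (DFunLike.congr_fun h f) g
  refine (Module.Basis.mk h₁ h₂).ext fun p => (Module.Basis.mk h₁ h₂).ext fun p' => ?_
  change _ = form n τ q t (Module.Basis.mk h₁ h₂ p') (Module.Basis.mk h₁ h₂ p)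
  rw [Module.Basis.mk_apply, Module.Basis.mk_apply]
  by_cases h : p = p'
  · rw [h]
  · exact (form_macdonald_of_ne h₁ h₂ p.1 p'.1 p.2 p'.2 h).trans
      (form_macdonald_of_ne h₁ h₂ p'.1 p.1 p'.2 p.2 (Ne.symm h)).symm

theorem form_self_pos (h₁ : LinearIndependent ℝ (macdonaldFamily n τ q t))
    (h₂ : ⊤ ≤ Submodule.span ℝ (Set.range (macdonaldFamily n τ q t)))
    (hpos : ∀ (α : Fin (n + 1) → ℕ) (S : RSYT n τ), 0 < normSq q t α S) {f : P n τ} (hf : f ≠ 0) :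
    0 < form n τ q t f f := by
  rw [form_apply h₁ h₂]
  have hs : ((Module.Basis.mk h₁ h₂).repr f).support.Nonempty := by
    rw [Finsupp.support_nonempty_iff, Ne, LinearEquiv.map_eq_zero_iff]
    exact hf
  refine Finset.sum_pos (fun p hp => ?_) hs
  have h0 := Finsupp.mem_support_iff.1 hp
  have := mul_pos (hpos p.1 p.2) (mul_self_pos.2 h0)
  linarith [mul_left_comm ((Module.Basis.mk h₁ h₂).repr f p) (normSq q t p.1 p.2)
    ((Module.Basis.mk h₁ h₂).repr f p)]

end Form

end VVMacdonald

theorem mainTheorem1 (n : ℕ) (τ : YoungDiagram) (hτ : τ.card = n + 1)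
    (hdim : 2 ≤ Module.finrank ℝ (VVMacdonald.V n τ))
    (q t : ℝ) (hq : 0 < q) (ht : 0 < t) (hq1 : q ≠ 1) (ht1 : t ≠ 1) :
    -- the two descriptions of the region are equivalent
    (((q < min (t ^ (-(VVMacdonald.maxHook τ : ℤ))) (t ^ (VVMacdonald.maxHook τ : ℤ)) ∨
        max (t ^ (-(VVMacdonald.maxHook τ : ℤ))) (t ^ (VVMacdonald.maxHook τ : ℤ)) < q) ↔
      (min (q ^ (-(1 / (VVMacdonald.maxHook τ : ℝ)))) (q ^ (1 / (VVMacdonald.maxHook τ : ℝ))) < t ∧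
        t < max (q ^ (-(1 / (VVMacdonald.maxHook τ : ℝ))))
          (q ^ (1 / (VVMacdonald.maxHook τ : ℝ)))))) ∧
    ((min (q ^ (-(1 / (VVMacdonald.maxHook τ : ℝ)))) (q ^ (1 / (VVMacdonald.maxHook τ : ℝ))) < t ∧
        t < max (q ^ (-(1 / (VVMacdonald.maxHook τ : ℝ))))
          (q ^ (1 / (VVMacdonald.maxHook τ : ℝ)))) →
      -- the form is the symmetric bilinear form given by the norms of the orthogonal basis `M_{α,S}`
      (LinearIndependent ℝ (VVMacdonald.macdonaldFamily n τ q t) ∧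
        Submodule.span ℝ (Set.range (VVMacdonald.macdonaldFamily n τ q t)) = ⊤) ∧
      (∀ f g : VVMacdonald.P n τ,
        VVMacdonald.form n τ q t f g = VVMacdonald.form n τ q t g f) ∧
      (∀ (α β : Fin (n + 1) → ℕ) (S S' : VVMacdonald.RSYT n τ), (α, S) ≠ (β, S') →
        VVMacdonald.form n τ q t (VVMacdonald.macdonald q t S α)
          (VVMacdonald.macdonald q t S' β) = 0) ∧
      (∀ (α : Fin (n + 1) → ℕ) (S : VVMacdonald.RSYT n τ),
        VVMacdonald.form n τ q t (VVMacdonald.macdonald q t S α)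
          (VVMacdonald.macdonald q t S α) = VVMacdonald.normSq q t α S) ∧
      -- positive-definiteness
      (∀ f : VVMacdonald.P n τ, f ≠ 0 → 0 < VVMacdonald.form n τ q t f f) ∧
      (∀ (α : Fin (n + 1) → ℕ) (S : VVMacdonald.RSYT n τ),
        0 < VVMacdonald.form n τ q t (VVMacdonald.macdonald q t S α)
          (VVMacdonald.macdonald q t S α))) := by
  have hh : 0 < VVMacdonald.maxHook τ := VVMacdonald.maxHook_pos (by omega)
  have hiff := VVMacdonald.region_iff hq ht hh
  refine ⟨hiff, fun hr => ?_⟩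
  have h₁ := VVMacdonald.linearIndependent_macdonaldFamily (n := n) (τ := τ) hq.ne' ht ht1
  have h₂ := VVMacdonald.span_macdonaldFamily (n := n) (τ := τ) hq.ne' ht ht1
  have hpos := VVMacdonald.normSq_pos (n := n) hq ht ht1 (hiff.2 hr)
  refine ⟨⟨h₁, h₂⟩, VVMacdonald.form_comm h₁ h₂.ge, VVMacdonald.form_macdonald_of_ne h₁ h₂.ge,
    VVMacdonald.form_macdonald_self h₁ h₂.ge,
    fun f hf => VVMacdonald.form_self_pos h₁ h₂.ge hpos hf, fun α S => ?_⟩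
  rw [VVMacdonald.form_macdonald_self h₁ h₂.ge]
  exact hpos α S
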